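/- Let $n\ge 1$, let $\Omega\subset\mathbb R^n$ be a bounded open set with Lipschitz boundary, and let $0<s<1$. For an open set $U\subset\mathbb R^n$ let $H^s(U)$ be the space of real functions $\phi\in L^2(U)$ with $$\|\phi\|_{s,U}^2=\int_U|\phi|^2\,dx+\int_{U\times U}\frac{|\phi(x)-\phi(x')|^2}{|x-x'|^{n+2s}}\,dx\,dx'<\infty .$$ Let $Y=\,]0,1[^n$, let $\vec e_1,\dots,\vec e_n$ be the canonical basis and $[\,\cdot\,]$ the componentwise integer part. For $\varepsilon>0$ put $$\widehat\Omega_{\varepsilon,3}=\{x:\operatorname{dist}(x,\partial\Omega)<3\sqrt n\,\varepsilon\},\qquad \widetilde\Omega_{\varepsilon,3}=\{x:\operatorname{dist}(x,\Omega)<3\sqrt n\,\varepsilon\},$$ and, for $u\in L^2(\mathbb R^n)$, $$M_Y^\varepsilon(u)(x)=\frac1{|Y|}\int_Y u\Bigl(\varepsilon\Bigl[\frac x\varepsilon\Bigr]+\varepsilon z\Bigr)dz .$$ Let $\mathcal Q_\varepsilon(u)$ be the $Q_1$-interpolate of $M_Y^\varepsilon(u)$, that is, the continuous function on $\mathbb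 R^n$ which is affine in each variable separately on every cell $\varepsilon(\xi+\overline Y)$, $\xi\in\mathbb Z^n$, and equals $M_Y^\varepsilon(u)(\varepsilon\xi)$ at every node $\varepsilon\xi$, $\xi\in\mathbb Z^n$. There exists a bounded linear extension operator $\mathcal P:H^s(\Omega)\to H^s(\mathbb R^n)$, i.e. a linear map with $\mathcal P(\phi)=\phi$ a.e. on $\Omega$ and $\|\mathcal P(\phi)\|_{s,\mathbb R^n}\le K\|\phi\|_{s,\Omega}$ for some constant $K$ and all $\phi\in H^s(\Omega)$. Moreover, for every $K\ge0$ there is a constant $C>0$, depending only on $n$, $s$, $\Omega$ and $K$, such that for every such operator $\mathcal P$ with bound $K$, every $\varepsilon>0$ and every $\phi\in H^s(\Omega)$, the extension $\mathcal P(\phi)$ being still denoted $\phi$, $$\|\phi-M_Y^\varepsilon(\phi)\|_{L^2(\Omega)}\le C\varepsilon^s\|\phi\|_{s,\Omega},\qquad \|\phi-\mathcal Q_\varepsilon(\phi)\|_{L^2(\Omega)}\le C\varepsilon^s\|\phi\|_{s,\Omega},$$ $$\|\nabla\mathcal Q_\varepsilon(\phi)\|_{[L^2(\widetilde\Omega_{\varepsilon,3})]^n}\le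 C\varepsilon^{s-1}\|\phi\|_{s,\Omega},\qquad \|\phi\|_{L^2(\widehat\Omega_{\varepsilon,3})}\le C\varepsilon^{s/2}\|\phi\|_{s,\Omega},$$ $$\|\phi-\phi(\cdot+\varepsilon\vec e_i)\|_{L^2(\Omega)}\le C\varepsilon^s\|\phi\|_{s,\Omega}\quad(1\le i\le n),\qquad \|\mathcal Q_\varepsilon(\phi)\|_{L^2(\partial\Omega)}\le C\varepsilon^{(s-1)/2}\|\phi\|_{s,\Omega},$$ where $\nabla$ is the weak gradient. -/

import Mathlib

open MeasureTheory Set Metric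
open scoped ENNReal NNReal ContDiff RealInnerProductSpace

noncomputable section

/-- `ℝⁿ` with its Euclidean norm. -/
abbrev Rn (n : ℕ) : Type := EuclideanSpace ℝ (Fin n)

/-- The set `Ω` has Lipschitz boundary: near each boundary point there are a unit vector `e`
(the local vertical direction) and a Lipschitz function `γ` such that, in a neighbourhood of the
point, `Ω` is the set of points lying strictly above the graph of `γ`. The argument
`y - ⟪e, y⟫ e` of `γ` is the orthogonal projection of `y` on the hyperplane `e^⊥`. -/
def HasLipschitzBoundary {n : ℕ} (Ω : Set (Rn n)) : Prop :=
  ∀ x ∈ frontier Ω, ∃ (e : Rn n) (γ : Rn n → ℝ) (L : ℝ≥0) (r : ℝ),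
    ‖e‖ = 1 ∧ LipschitzWith L γ ∧ 0 < r ∧
      ∀ y ∈ ball x r, y ∈ Ω ↔ γ (y - ⟪e, y⟫ • e) < ⟪e, y⟫

/-- The norm `‖φ‖_{s,Ω}` of `H^s(Ω)`, with values in `[0, ∞]`: the square root of
`∫_Ω |φ|² + ∫_{Ω×Ω} |φ(x) - φ(x')|² / |x - x'|^(n+2s) dx dx'`. -/
def hsNorm {n : ℕ} (s : ℝ) (Ω : Set (Rn n)) (φ : Rn n → ℝ) : ℝ≥0∞ :=
  ((∫⁻ x in Ω, ENNReal.ofReal (φ x ^ 2)) +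
    ∫⁻ x in Ω, ∫⁻ x' in Ω,
      ENNReal.ofReal ((φ x - φ x') ^ 2 / ‖x - x'‖ ^ ((n : ℝ) + 2 * s))) ^ (1 / 2 : ℝ)

/-- `φ` is (a representative of) an element of `H^s(Ω)`. -/
def MemHs {n : ℕ} (s : ℝ) (Ω : Set (Rn n)) (φ : Rn n → ℝ) : Prop :=
  AEStronglyMeasurable φ (volume.restrict Ω) ∧ hsNorm s Ω φ < ⊤

/-- `P` is a linear extension operator from `H^s(Ω)` to `H^s(ℝⁿ)` of norm at most `K`. Elements
of these spaces are classes of functions modulo equality almost everywhere. -/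
structure IsHsExtension {n : ℕ} (s : ℝ) (Ω : Set (Rn n)) (K : ℝ≥0)
    (P : (Rn n → ℝ) → (Rn n → ℝ)) : Prop where
  memHs : ∀ φ, MemHs s Ω φ → MemHs s univ (P φ)
  extends_ae : ∀ φ, MemHs s Ω φ → P φ =ᵐ[volume.restrict Ω] φ
  linear_ae : ∀ (a b : ℝ) (φ ψ : Rn n → ℝ), MemHs s Ω φ → MemHs s Ω ψ →
    P (fun x => a * φ x + b * ψ x) =ᵐ[volume] fun x => a * P φ x + b * P ψ x
  norm_le : ∀ φ, MemHs s Ω φ → hsNorm s univ (P φ) ≤ K * hsNorm s Ω φ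

/-- The reference cell `Y = ]0,1[ⁿ`. -/
def unitCell (n : ℕ) : Set (Rn n) := {y | ∀ i, y i ∈ Ioo (0 : ℝ) 1}

/-- A point of `ℤⁿ` seen in `ℝⁿ`. -/
def latticePoint {n : ℕ} (ξ : Fin n → ℤ) : Rn n := WithLp.toLp 2 fun i => (ξ i : ℝ)

/-- The integer part `[x] ∈ ℤⁿ`, for which `x - [x]` lies in `Y` for almost every `x`. -/
def intPart {n : ℕ} (x : Rn n) : Fin n → ℤ := fun i => ⌊x i⌋

/-- The mean `(1/|Y|) ∫_Y φ(εξ + εz) dz` of `φ` over the cell `ε(ξ + Y)`. -/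
def cellMean {n : ℕ} (ε : ℝ) (φ : Rn n → ℝ) (ξ : Fin n → ℤ) : ℝ :=
  ⨍ z in unitCell n, φ (ε • latticePoint ξ + ε • z)

/-- The cell-average approximation `M_Y^ε(φ)(x) = (1/|Y|) ∫_Y φ(ε[x/ε] + εz) dz`. -/
def cellAverage {n : ℕ} (ε : ℝ) (φ : Rn n → ℝ) (x : Rn n) : ℝ :=
  cellMean ε φ (intPart (ε⁻¹ • x))

/-- `𝒬_ε(φ)`, the `Q₁`-interpolate of the discrete function `M_Y^ε(φ)`: the continuous function
that is affine in each variable on each cell `ε(ξ + Y)` and takes at each node `εξ`, `ξ ∈ ℤⁿ`,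
the value `M_Y^ε(φ)(εξ)`. A vertex of the cell of `x` is `ε([x/ε] + κ)` with `κ ∈ {0,1}ⁿ`. -/
def q1Interp {n : ℕ} (ε : ℝ) (φ : Rn n → ℝ) (x : Rn n) : ℝ :=
  ∑ κ : Fin n → Fin 2,
    cellMean ε φ (fun i => intPart (ε⁻¹ • x) i + ((κ i : ℕ) : ℤ)) *
      ∏ i, (if κ i = 1 then Int.fract ((ε⁻¹ • x) i) else 1 - Int.fract ((ε⁻¹ • x) i))

/-- `G` is the weak (distributional) gradient of `f` in the open set `U`. -/
def HasWeakGradientOn {n : ℕ} (U : Set (Rn n)) (f : Rn n → ℝ) (G : Rn n → Rn n) : Prop :=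
  LocallyIntegrableOn f U ∧ LocallyIntegrableOn G U ∧
    ∀ ψ : Rn n → ℝ, ContDiff ℝ ∞ ψ → HasCompactSupport ψ → tsupport ψ ⊆ U → ∀ i : Fin n,
      ∫ x in U, f x * fderiv ℝ ψ x (EuclideanSpace.single i 1) = -∫ x in U, G x i * ψ x

/-- `Ω̂_{ε,k}`, the set of points at distance less than `k √n ε` from `∂Ω`. -/
def boundaryLayer {n : ℕ} (Ω : Set (Rn n)) (ε : ℝ) (k : ℕ) : Set (Rn n) :=
  thickening (k * √n * ε) (frontier Ω)

/-- `Ω̃_{ε,k}`, the set of points at distance less than `k √n ε` from `Ω`. -/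
def enlargement {n : ℕ} (Ω : Set (Rn n)) (ε : ℝ) (k : ℕ) : Set (Rn n) :=
  thickening (k * √n * ε) Ω

/-- The surface measure on `∂Ω`: the `(n-1)`-dimensional Hausdorff measure restricted to `∂Ω`
(Mathlib's normalization differs from the classical one by a factor depending only on `n`). -/
def surfaceMeasure {n : ℕ} (Ω : Set (Rn n)) : Measure (Rn n) :=
  (Measure.hausdorffMeasure ((n : ℝ) - 1)).restrict (frontier Ω)

end

/-!
All estimates are proved for an arbitrary function `u` on `ℝⁿ` and transferred to `u = 𝒫(φ)`.

*Interior estimates.* The values of `M_Y^ε(u)` and `𝒬_ε(u)` at `x` are averages of `u` within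
distance `2√n ε` of `x`, so by Jensen the squared errors are at most `ε⁻ⁿ` times the local
oscillation `∫_{|x - y| ≤ 2√n ε} |u(x) - u(y)|² dy`. Its integral over `x` is at most
`(2√n ε)^(n+2s)` times the Gagliardo energy of `u`, since `|x - y|^(n+2s) ≤ (2√n ε)^(n+2s)` there.

*Boundary layer.* In a chart, translating the strip of width `w` along the boundary upwards by `w`
moves it onto the adjacent strip and changes `u` by at most `C w^s ‖u‖_s` in `L²`. Hence its mass is
at most about half that of the strip of width `2w`, plus `C w^(2s) ‖u‖_s²`. Since `2^s < 2`,
iterating up to unit width bounds the mass by `C w^s ‖u‖_s²`. The surface estimate follows from the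
layer estimate and Fubini, since the surface measure of a ball of radius `ε` is `O(ε^(n-1))`.

*Extension.* Reflecting a one-sided neighbourhood of a boundary point across the Lipschitz graph is
a Lipschitz map onto points of `Ω`. Composition with it preserves `H^s`, and Lipschitz weights glue
the local extensions.
-/

section SobolevEnergy

variable {n : ℕ}

/-- The Gagliardo double integral of `φ` on `Ω × Ω`, the square of the seminorm of `H^s(Ω)`. -/
noncomputable def gagliardo (s : ℝ) (Ω : Set (Rn n)) (φ : Rn n → ℝ) : ℝ≥0∞ :=
  ∫⁻ x in Ω, ∫⁻ x' in Ω,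
    ENNReal.ofReal ((φ x - φ x') ^ 2 / ‖x - x'‖ ^ ((n : ℝ) + 2 * s))

/-- The square of the norm of `H^s(Ω)`. -/
noncomputable def hsEnergy (s : ℝ) (Ω : Set (Rn n)) (φ : Rn n → ℝ) : ℝ≥0∞ :=
  (∫⁻ x in Ω, ENNReal.ofReal (φ x ^ 2)) + gagliardo s Ω φ

theorem hsNorm_eq_hsEnergy_rpow (s : ℝ) (Ω : Set (Rn n)) (φ : Rn n → ℝ) :
    hsNorm s Ω φ = hsEnergy s Ω φ ^ (1 / 2 : ℝ) := rfl

theorem gagliardo_le_hsEnergy (s : ℝ) (Ω : Set (Rn n)) (φ : Rn n → ℝ) :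
    gagliardo s Ω φ ≤ hsEnergy s Ω φ := le_add_self

theorem lintegral_sq_le_hsEnergy (s : ℝ) (Ω : Set (Rn n)) (φ : Rn n → ℝ) :
    ∫⁻ x in Ω, ENNReal.ofReal (φ x ^ 2) ≤ hsEnergy s Ω φ := le_self_add

theorem hsEnergy_congr_ae {s : ℝ} {Ω : Set (Rn n)} {φ ψ : Rn n → ℝ}
    (h : φ =ᵐ[volume.restrict Ω] ψ) : hsEnergy s Ω φ = hsEnergy s Ω ψ := by
  unfold hsEnergy gagliardo
  congr 1
  · exact lintegral_congr_ae (h.mono fun x hx => by simp only [hx])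
  · refine lintegral_congr_ae (h.mono fun x hx => ?_)
    exact lintegral_congr_ae (h.mono fun y hy => by simp only [hx, hy])

end SobolevEnergy

section SquareNorm

variable {α F : Type*} [MeasurableSpace α] [NormedAddCommGroup F] {μ : Measure α}

theorem lintegral_norm_sq_eq_eLpNorm_sq (f : α → F) :
    ∫⁻ x, ENNReal.ofReal (‖f x‖ ^ 2) ∂μ = eLpNorm f 2 μ ^ 2 := by
  rw [eLpNorm_eq_lintegral_rpow_enorm_toReal (by norm_num) (by norm_num),
    ← ENNReal.rpow_natCast, ← ENNReal.rpow_mul]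
  norm_num

theorem eLpNorm_le_hsNorm_of_lintegral_sq_le {n : ℕ} {s : ℝ} {u : Rn n → ℝ} {f : α → F}
    {a t p : ℝ} (ha : 0 ≤ a) (ht : 0 ≤ t)
    (h : ∫⁻ x, ENNReal.ofReal (‖f x‖ ^ 2) ∂μ ≤
      ENNReal.ofReal (a * t ^ (2 * p)) * hsEnergy s univ u) :
    eLpNorm f 2 μ ≤ ENNReal.ofReal (√a * t ^ p) * hsNorm s univ u := by
  have hsq : (√a * t ^ p) ^ 2 = a * t ^ (2 * p) := by
    rw [mul_pow, Real.sq_sqrt ha, mul_comm 2 p, Real.rpow_mul ht, Real.rpow_ofNat]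
  have henergy : hsNorm s univ u ^ 2 = hsEnergy s univ u := by
    rw [hsNorm_eq_hsEnergy_rpow, ← ENNReal.rpow_mul_natCast]
    norm_num
  rw [← ENNReal.pow_le_pow_left_iff two_ne_zero, mul_pow, ← ENNReal.ofReal_pow (by positivity),
    hsq, henergy, ← lintegral_norm_sq_eq_eLpNorm_sq]
  exact h

end SquareNorm

theorem ofReal_sq_sub_le_two_mul (a b c : ℝ) : ENNReal.ofReal ((a - b) ^ 2) ≤
    2 * ENNReal.ofReal ((a - c) ^ 2) + 2 * ENNReal.ofReal ((b - c) ^ 2) := by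
  have htwo : (2 : ℝ≥0∞) = ENNReal.ofReal 2 := by simp only [ENNReal.ofReal_ofNat]
  rw [htwo, ← ENNReal.ofReal_mul (by norm_num), ← ENNReal.ofReal_mul (by norm_num),
    ← ENNReal.ofReal_add (by positivity) (by positivity)]
  exact ENNReal.ofReal_le_ofReal (by nlinarith [sq_nonneg (a - c + (b - c))])

section ClosedBall

variable {X : Type*} [PseudoMetricSpace X] [SecondCountableTopology X] [MeasurableSpace X]
  [OpensMeasurableSpace X] {μ ν : Measure X} [SFinite ν]

theorem measurableSet_setOf_dist_le (r : ℝ) : MeasurableSet {p : X × X | dist p.2 p.1 ≤ r} :=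
  measurableSet_le (measurable_snd.dist measurable_fst) measurable_const

theorem aemeasurable_lintegral_closedBall {F : X → X → ℝ≥0∞}
    (hF : AEMeasurable (Function.uncurry F) (μ.prod ν)) (r : ℝ) :
    AEMeasurable (fun x => ∫⁻ y in closedBall x r, F x y ∂ν) μ := by
  have hind : ∀ x, ∫⁻ y in closedBall x r, F x y ∂ν =
      ∫⁻ y, {p : X × X | dist p.2 p.1 ≤ r}.indicator (Function.uncurry F) (x, y) ∂ν := by
    intro x
    rw [← lintegral_indicator measurableSet_closedBall]
    rfl
  simp_rw [hind]
  exact (hF.indicator (measurableSet_setOf_dist_le r)).lintegral_prod_right'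

theorem lintegral_lintegral_closedBall [SFinite μ] {F : X → ℝ≥0∞} (hF : AEMeasurable F ν)
    (r : ℝ) :
    ∫⁻ x, ∫⁻ y in closedBall x r, F y ∂ν ∂μ = ∫⁻ y, F y * μ (closedBall y r) ∂ν := by
  have hind : ∀ x, ∫⁻ y in closedBall x r, F y ∂ν =
      ∫⁻ y, {p : X × X | dist p.2 p.1 ≤ r}.indicator (fun p => F p.2) (x, y) ∂ν := by
    intro x
    rw [← lintegral_indicator measurableSet_closedBall]
    rfl
  simp_rw [hind]
  rw [lintegral_lintegral_swap
    (f := fun x y => {p : X × X | dist p.2 p.1 ≤ r}.indicator (fun p => F p.2) (x, y))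
    (hF.comp_snd.indicator (measurableSet_setOf_dist_le r))]
  refine lintegral_congr fun y => ?_
  have hswap : ∀ x, {p : X × X | dist p.2 p.1 ≤ r}.indicator (fun p => F p.2) (x, y) =
      (closedBall y r).indicator (fun _ => F y) x := fun x => by
    simp only [indicator, mem_ofPred_eq, mem_closedBall, dist_comm]
  simp_rw [hswap]
  rw [lintegral_indicator measurableSet_closedBall, setLIntegral_const]

end ClosedBall

section Oscillation

variable {n : ℕ} {s : ℝ} {u : Rn n → ℝ}

/-- The local quadratic oscillation of `u` about `x` at scale `r`, not divided by the volume of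
the ball. All approximation errors are compared with it. -/
noncomputable def ballOscillation (u : Rn n → ℝ) (r : ℝ) (x : Rn n) : ℝ≥0∞ :=
  ∫⁻ y in closedBall x r, ENNReal.ofReal ((u x - u y) ^ 2)

theorem aemeasurable_ballOscillation (hu : AEMeasurable u) (r : ℝ) :
    AEMeasurable (ballOscillation u r) :=
  aemeasurable_lintegral_closedBall
    ((hu.comp_fst.sub hu.comp_snd).pow_const 2).ennreal_ofReal r

theorem ballOscillation_mono {r r' : ℝ} (h : r ≤ r') (x : Rn n) :
    ballOscillation u r x ≤ ballOscillation u r' x :=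
  lintegral_mono_set (closedBall_subset_closedBall h)

theorem ofReal_sq_le_rpow_mul_of_norm_sub_le {x y : Rn n} {d r p : ℝ} (hp : 0 ≤ p)
    (hd : x = y → d = 0) (h : ‖x - y‖ ≤ r) :
    ENNReal.ofReal (d ^ 2) ≤
      ENNReal.ofReal (r ^ p) * ENNReal.ofReal (d ^ 2 / ‖x - y‖ ^ p) := by
  rw [← ENNReal.ofReal_mul (by have := (norm_nonneg _).trans h; positivity)]
  apply ENNReal.ofReal_le_ofReal
  rcases eq_or_ne x y with hxy | hxy
  · simp [hd hxy]
  · have hpos : 0 < ‖x - y‖ := norm_pos_iff.2 (sub_ne_zero.2 hxy)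
    calc d ^ 2 = ‖x - y‖ ^ p * (d ^ 2 / ‖x - y‖ ^ p) := by field_simp
      _ ≤ r ^ p * (d ^ 2 / ‖x - y‖ ^ p) := by gcongr

theorem lintegral_ballOscillation_le (hs : 0 ≤ s) (u : Rn n → ℝ) (r : ℝ) :
    ∫⁻ x, ballOscillation u r x ≤
      ENNReal.ofReal (r ^ ((n : ℝ) + 2 * s)) * hsEnergy s univ u := by
  refine le_trans ?_ (mul_le_mul_right (gagliardo_le_hsEnergy s univ u) _)
  simp only [gagliardo, ballOscillation, Measure.restrict_univ]
  simp_rw [← lintegral_const_mul' _ _ ENNReal.ofReal_ne_top]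
  refine lintegral_mono fun x => ?_
  refine (setLIntegral_mono' measurableSet_closedBall fun y hy => ?_).trans
    (setLIntegral_le_lintegral _ _)
  refine ofReal_sq_le_rpow_mul_of_norm_sub_le (by positivity) (fun h => by simp [h]) ?_
  rwa [mem_closedBall, dist_comm, dist_eq_norm] at hy

/-- Both `u x` and `u (x + v)` are compared with the values of `u` on the ball of radius `‖v‖`
about `x`. -/
theorem volume_closedBall_mul_sq_sub_translate_le (hu : AEMeasurable u) (v x : Rn n) :
    volume (closedBall (0 : Rn n) ‖v‖) * ENNReal.ofReal ((u x - u (x + v)) ^ 2) ≤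
      2 * ballOscillation u ‖v‖ x + 2 * ballOscillation u (2 * ‖v‖) (x + v) := by
  have hsub : closedBall x ‖v‖ ⊆ closedBall (x + v) (2 * ‖v‖) :=
    closedBall_subset_closedBall' (by rw [dist_self_add_right]; linarith)
  have hmeas : AEMeasurable (fun y => 2 * ENNReal.ofReal ((u x - u y) ^ 2))
      (volume.restrict (closedBall x ‖v‖)) :=
    ((hu.restrict.const_sub _).pow_const 2).ennreal_ofReal.const_mul 2
  calc volume (closedBall (0 : Rn n) ‖v‖) * ENNReal.ofReal ((u x - u (x + v)) ^ 2)
      = ∫⁻ _ in closedBall x ‖v‖, ENNReal.ofReal ((u x - u (x + v)) ^ 2) := by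
        rw [setLIntegral_const, mul_comm, ← Measure.addHaar_closedBall_center]
    _ ≤ ∫⁻ y in closedBall x ‖v‖, (2 * ENNReal.ofReal ((u x - u y) ^ 2) +
          2 * ENNReal.ofReal ((u (x + v) - u y) ^ 2)) :=
        lintegral_mono fun y => ofReal_sq_sub_le_two_mul _ _ _
    _ = 2 * ballOscillation u ‖v‖ x +
          2 * ∫⁻ y in closedBall x ‖v‖, ENNReal.ofReal ((u (x + v) - u y) ^ 2) := by
        rw [lintegral_add_left' hmeas, lintegral_const_mul' _ _ ENNReal.ofNat_ne_top,
          lintegral_const_mul' _ _ ENNReal.ofNat_ne_top, ballOscillation]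
    _ ≤ 2 * ballOscillation u ‖v‖ x + 2 * ballOscillation u (2 * ‖v‖) (x + v) := by
        gcongr
        exact lintegral_mono_set hsub

theorem volume_closedBall_mul_lintegral_sq_sub_translate_le (hs : 0 ≤ s) (hu : AEMeasurable u)
    (v : Rn n) :
    volume (closedBall (0 : Rn n) ‖v‖) * ∫⁻ x, ENNReal.ofReal ((u x - u (x + v)) ^ 2) ≤
      ENNReal.ofReal (4 * (2 * ‖v‖) ^ ((n : ℝ) + 2 * s)) * hsEnergy s univ u := by
  calc volume (closedBall (0 : Rn n) ‖v‖) * ∫⁻ x, ENNReal.ofReal ((u x - u (x + v)) ^ 2)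
      ≤ ∫⁻ x, (2 * ballOscillation u ‖v‖ x + 2 * ballOscillation u (2 * ‖v‖) (x + v)) := by
        rw [← lintegral_const_mul' _ _ measure_closedBall_lt_top.ne]
        exact lintegral_mono (volume_closedBall_mul_sq_sub_translate_le hu v)
    _ = 2 * (∫⁻ x, ballOscillation u ‖v‖ x) + 2 * ∫⁻ x, ballOscillation u (2 * ‖v‖) x := by
        rw [lintegral_add_left' ((aemeasurable_ballOscillation hu _).const_mul 2),
          lintegral_const_mul' _ _ ENNReal.ofNat_ne_top,
          lintegral_const_mul' _ _ ENNReal.ofNat_ne_top,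
          lintegral_add_right_eq_self (ballOscillation u (2 * ‖v‖))]
    _ ≤ 4 * ∫⁻ x, ballOscillation u (2 * ‖v‖) x := by
        have hmono := lintegral_mono (μ := volume) <|
          ballOscillation_mono (u := u) (r := ‖v‖) (r' := 2 * ‖v‖) (by linarith [norm_nonneg v])
        calc _ ≤ 2 * (∫⁻ x, ballOscillation u (2 * ‖v‖) x) +
              2 * ∫⁻ x, ballOscillation u (2 * ‖v‖) x := by gcongr
          _ = _ := by ring
    _ ≤ _ := by
        rw [ENNReal.ofReal_mul (by norm_num), ENNReal.ofReal_ofNat, mul_assoc]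
        gcongr
        exact lintegral_ballOscillation_le hs u _

theorem exists_lintegral_sq_sub_translate_le (n : ℕ) {s : ℝ} (hs : 0 < s) :
    ∃ C : ℝ, 0 ≤ C ∧ ∀ (u : Rn n → ℝ), AEMeasurable u → ∀ v : Rn n,
      ∫⁻ x, ENNReal.ofReal ((u x - u (x + v)) ^ 2) ≤
        ENNReal.ofReal (C * ‖v‖ ^ (2 * s)) * hsEnergy s univ u := by
  set β := volume.real (closedBall (0 : Rn n) 1) with hβ
  have hβpos : 0 < β := ENNReal.toReal_pos (measure_closedBall_pos _ _ one_pos).ne'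
    measure_closedBall_lt_top.ne
  refine ⟨4 * 2 ^ ((n : ℝ) + 2 * s) / β, by positivity, fun u hu v => ?_⟩
  rcases eq_or_ne v 0 with rfl | hv
  · simp
  have hv : 0 < ‖v‖ := norm_pos_iff.2 hv
  have hvol : volume (closedBall (0 : Rn n) ‖v‖) = ENNReal.ofReal (‖v‖ ^ n * β) := by
    rw [Measure.addHaar_closedBall' _ _ hv.le, finrank_euclideanSpace_fin,
      ENNReal.ofReal_mul (by positivity), hβ, ofReal_measureReal measure_closedBall_lt_top.ne]
  have hbound := volume_closedBall_mul_lintegral_sq_sub_translate_le hs.le hu v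
  rw [hvol] at hbound
  rw [← ENNReal.mul_le_mul_iff_right (a := ENNReal.ofReal (‖v‖ ^ n * β)) (by positivity)
    ENNReal.ofReal_ne_top]
  refine hbound.trans_eq ?_
  rw [← mul_assoc, ← ENNReal.ofReal_mul (by positivity), Real.mul_rpow two_pos.le hv.le,
    Real.rpow_add hv, Real.rpow_natCast]
  congr 2
  field_simp

theorem exists_eLpNorm_sub_translate_le (n : ℕ) {s : ℝ} (hs : 0 < s) :
    ∃ C : ℝ≥0, ∀ u : Rn n → ℝ, AEMeasurable u → ∀ v : Rn n,
      eLpNorm (fun x => u x - u (x + v)) 2 volume ≤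
        ENNReal.ofReal (C * ‖v‖ ^ s) * hsNorm s univ u := by
  obtain ⟨C, hC0, hC⟩ := exists_lintegral_sq_sub_translate_le n hs
  refine ⟨⟨√C, Real.sqrt_nonneg _⟩, fun u hu v => ?_⟩
  refine eLpNorm_le_hsNorm_of_lintegral_sq_le hC0 (norm_nonneg v) ?_
  simpa only [Real.norm_eq_abs, sq_abs] using hC u hu v

end Oscillation

section CellMeans

theorem ofReal_sq_sub_integral_le {α : Type*} [MeasurableSpace α] (μ : Measure α)
    [IsProbabilityMeasure μ] {f : α → ℝ} (hf : AEStronglyMeasurable f μ) (a : ℝ) :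
    ENNReal.ofReal ((a - ∫ z, f z ∂μ) ^ 2) ≤ ∫⁻ z, ENNReal.ofReal ((a - f z) ^ 2) ∂μ := by
  have hmeas : AEStronglyMeasurable (fun z => a - f z) μ := aestronglyMeasurable_const.sub hf
  have hnorm : ∫⁻ z, ENNReal.ofReal ((a - f z) ^ 2) ∂μ = eLpNorm (fun z => a - f z) 2 μ ^ 2 := by
    simp_rw [← lintegral_norm_sq_eq_eLpNorm_sq, Real.norm_eq_abs, sq_abs]
  rw [hnorm]
  by_cases hfin : eLpNorm (fun z => a - f z) 2 μ = ⊤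
  · simp [hfin]
  have hint : Integrable (fun z => a - f z) μ :=
    MemLp.integrable one_le_two ⟨hmeas, lt_top_iff_ne_top.2 hfin⟩
  have hfint : Integrable f μ := by
    simpa [Pi.sub_def] using (integrable_const a).sub hint
  have hmean : a - ∫ z, f z ∂μ = ∫ z, (a - f z) ∂μ := by
    rw [integral_sub (integrable_const a) hfint]; simp
  rw [hmean, ← sq_abs, ENNReal.ofReal_pow (abs_nonneg _), ← Real.norm_eq_abs, ofReal_norm]
  gcongr
  calc ‖∫ z, (a - f z) ∂μ‖ₑ ≤ ∫⁻ z, ‖a - f z‖ₑ ∂μ := enorm_integral_le_lintegral_enorm _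
    _ = eLpNorm (fun z => a - f z) 1 μ := eLpNorm_one_eq_lintegral_enorm.symm
    _ ≤ _ := eLpNorm_le_eLpNorm_of_exponent_le one_le_two hmeas

theorem unitCell_eq_preimage (n : ℕ) :
    unitCell n = WithLp.ofLp ⁻¹' (univ.pi fun _ : Fin n => Ioo (0 : ℝ) 1) := by
  ext y; simp [unitCell]

theorem measurableSet_unitCell (n : ℕ) : MeasurableSet (unitCell n) := by
  rw [unitCell_eq_preimage]
  exact (PiLp.volume_preserving_ofLp (Fin n)).measurable
    (MeasurableSet.univ_pi fun _ => measurableSet_Ioo)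

theorem volume_unitCell (n : ℕ) : volume (unitCell n) = 1 := by
  rw [unitCell_eq_preimage, (PiLp.volume_preserving_ofLp (Fin n)).measure_preimage
    (MeasurableSet.univ_pi fun _ => measurableSet_Ioo).nullMeasurableSet]
  simp [volume_pi_pi]

instance isProbabilityMeasure_restrict_unitCell (n : ℕ) :
    IsProbabilityMeasure ((volume : Measure (Rn n)).restrict (unitCell n)) :=
  ⟨by rw [Measure.restrict_apply_univ, volume_unitCell]⟩

variable {n : ℕ} {ε : ℝ}

theorem map_add_smul_volume (hε : 0 < ε) (c : Rn n) :
    (volume : Measure (Rn n)).map (fun z => c + ε • z) =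
      ENNReal.ofReal ((ε ^ n)⁻¹) • (volume : Measure (Rn n)) := by
  have hsmul := Measure.map_addHaar_smul (volume : Measure (Rn n)) hε.ne'
  rw [finrank_euclideanSpace_fin, abs_of_nonneg (by positivity)] at hsmul
  have hcomp : (fun z : Rn n => c + ε • z) = (fun w => c + w) ∘ (fun z => ε • z) := rfl
  rw [hcomp, ← Measure.map_map (by fun_prop) (by fun_prop), hsmul, Measure.map_smul,
    map_add_left_eq_self volume c]

theorem quasiMeasurePreserving_add_smul (hε : 0 < ε) (c : Rn n) :
    Measure.QuasiMeasurePreserving (fun z : Rn n => c + ε • z) :=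
  ⟨by fun_prop, by
    rw [map_add_smul_volume hε]
    exact Measure.smul_absolutelyContinuous⟩

theorem lintegral_unitCell_le (hε : 0 < ε) (c : Rn n) {S : Set (Rn n)}
    (hS : MeasurableSet S) (h : ∀ z ∈ unitCell n, c + ε • z ∈ S) (F : Rn n → ℝ≥0∞) :
    ∫⁻ z in unitCell n, F (c + ε • z) ≤ ENNReal.ofReal ((ε ^ n)⁻¹) * ∫⁻ y in S, F y := by
  have hemb : MeasurableEmbedding fun z : Rn n => c + ε • z :=
    ((Homeomorph.smulOfNeZero ε hε.ne').trans (Homeomorph.addLeft c)).measurableEmbedding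
  calc ∫⁻ z in unitCell n, F (c + ε • z)
      ≤ ∫⁻ z in unitCell n, S.indicator F (c + ε • z) :=
        setLIntegral_mono' (measurableSet_unitCell n) fun z hz => by
          rw [indicator_of_mem (h z hz)]
    _ ≤ ∫⁻ z, S.indicator F (c + ε • z) := setLIntegral_le_lintegral _ _
    _ = ∫⁻ y, S.indicator F y ∂((volume : Measure (Rn n)).map (fun z => c + ε • z)) :=
        (hemb.lintegral_map _).symm
    _ = _ := by
        rw [map_add_smul_volume hε, lintegral_smul_measure, lintegral_indicator hS, smul_eq_mul]

theorem ofReal_sq_sub_cellMean_le (hε : 0 < ε) {u : Rn n → ℝ} (hu : AEMeasurable u)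
    (a : ℝ) (ξ : Fin n → ℤ) {S : Set (Rn n)} (hS : MeasurableSet S)
    (h : ∀ z ∈ unitCell n, ε • latticePoint ξ + ε • z ∈ S) :
    ENNReal.ofReal ((a - cellMean ε u ξ) ^ 2) ≤
      ENNReal.ofReal ((ε ^ n)⁻¹) * ∫⁻ y in S, ENNReal.ofReal ((a - u y) ^ 2) := by
  have hmeas : AEStronglyMeasurable (fun z => u (ε • latticePoint ξ + ε • z))
      (volume.restrict (unitCell n)) :=
    (hu.aestronglyMeasurable.comp_quasiMeasurePreserving
      (quasiMeasurePreserving_add_smul hε _)).restrict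
  rw [cellMean, average_eq_integral]
  exact (ofReal_sq_sub_integral_le _ hmeas a).trans
    (lintegral_unitCell_le hε _ hS h fun y => ENNReal.ofReal ((a - u y) ^ 2))

/-- The vertex `[x/ε] + κ`, `κ ∈ {0,1}ⁿ`, of the lattice cell that contains `x/ε`. -/
noncomputable def vertex (ε : ℝ) (x : Rn n) (κ : Fin n → Fin 2) : Fin n → ℤ :=
  fun i => intPart (ε⁻¹ • x) i + ((κ i : ℕ) : ℤ)

theorem cellAverage_eq_cellMean_vertex (ε : ℝ) (u : Rn n → ℝ) (x : Rn n) :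
    cellAverage ε u x = cellMean ε u (vertex ε x 0) := by
  have hvertex : vertex ε x 0 = intPart (ε⁻¹ • x) := funext fun i => by simp [vertex]
  rw [cellAverage, hvertex]

theorem vertex_injective (ε : ℝ) (x : Rn n) : Function.Injective (vertex ε x) := by
  intro κ κ' h
  ext i
  simpa [vertex] using congrFun h i

theorem norm_le_sqrt_mul_of_abs_le {x : Rn n} {c : ℝ} (hc : 0 ≤ c) (h : ∀ i, |x i| ≤ c) :
    ‖x‖ ≤ √n * c := by
  rw [EuclideanSpace.norm_eq, ← Real.sqrt_sq hc, ← Real.sqrt_mul n.cast_nonneg]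
  refine Real.sqrt_le_sqrt ((Finset.sum_le_card_nsmul _ _ (c ^ 2) fun i _ => ?_).trans_eq ?_)
  · exact pow_le_pow_left₀ (norm_nonneg _) (h i) 2
  · simp

theorem vertexCell_mem_closedBall (hε : 0 < ε) (x : Rn n) (κ : Fin n → Fin 2) {z : Rn n}
    (hz : z ∈ unitCell n) :
    ε • latticePoint (vertex ε x κ) + ε • z ∈ closedBall x (2 * √n * ε) := by
  have hcoord : ∀ i, (ε • latticePoint (vertex ε x κ) + ε • z - x : Rn n) i =
      ε * (((κ i : ℕ) : ℝ) + z i - Int.fract (ε⁻¹ * x i)) := by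
    intro i
    have hx : x i = ε * ((⌊ε⁻¹ * x i⌋ : ℝ) + Int.fract (ε⁻¹ * x i)) := by
      rw [Int.floor_add_fract, mul_inv_cancel_left₀ hε.ne']
    simp only [latticePoint, vertex, intPart, PiLp.sub_apply, PiLp.add_apply, PiLp.smul_apply,
      smul_eq_mul, Int.cast_add, Int.cast_natCast]
    linear_combination -hx
  rw [mem_closedBall, dist_eq_norm, mul_right_comm, mul_comm]
  refine norm_le_sqrt_mul_of_abs_le (by positivity) fun i => ?_
  have hκ : ((κ i : ℕ) : ℝ) ≤ 1 := by exact_mod_cast Nat.lt_succ_iff.1 (κ i).2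
  have hfract := Int.fract_nonneg (ε⁻¹ * x i)
  have hfract' := Int.fract_lt_one (ε⁻¹ * x i)
  obtain ⟨hz0, hz1⟩ := hz i
  rw [hcoord, abs_mul, abs_of_pos hε, mul_comm]
  exact mul_le_mul_of_nonneg_right (abs_le.2 ⟨by linarith, by linarith⟩) hε.le

theorem ofReal_sq_sub_cellMean_vertex_le (hε : 0 < ε) {u : Rn n → ℝ} (hu : AEMeasurable u)
    (x : Rn n) (κ : Fin n → Fin 2) (a : ℝ) :
    ENNReal.ofReal ((a - cellMean ε u (vertex ε x κ)) ^ 2) ≤ ENNReal.ofReal ((ε ^ n)⁻¹) *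
      ∫⁻ y in closedBall x (2 * √n * ε), ENNReal.ofReal ((a - u y) ^ 2) :=
  ofReal_sq_sub_cellMean_le hε hu a _ measurableSet_closedBall fun _ hz =>
    vertexCell_mem_closedBall hε x κ hz

theorem lintegral_le_of_le_ballOscillation {s : ℝ} (hs : 0 ≤ s) (hε : 0 < ε) {u : Rn n → ℝ}
    {F : Rn n → ℝ≥0∞} {c : ℝ} (hc : 0 ≤ c)
    (h : ∀ x, F x ≤ ENNReal.ofReal (c * (ε ^ n)⁻¹) * ballOscillation u (2 * √n * ε) x) :
    ∫⁻ x, F x ≤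
      ENNReal.ofReal (c * (2 * √n) ^ ((n : ℝ) + 2 * s) * ε ^ (2 * s)) * hsEnergy s univ u := by
  calc ∫⁻ x, F x
      ≤ ENNReal.ofReal (c * (ε ^ n)⁻¹) * ∫⁻ x, ballOscillation u (2 * √n * ε) x := by
        rw [← lintegral_const_mul' _ _ ENNReal.ofReal_ne_top]
        exact lintegral_mono h
    _ ≤ ENNReal.ofReal (c * (ε ^ n)⁻¹) *
          (ENNReal.ofReal ((2 * √n * ε) ^ ((n : ℝ) + 2 * s)) * hsEnergy s univ u) := by
        gcongr
        exact lintegral_ballOscillation_le hs u _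
    _ = _ := by
        rw [← mul_assoc, ← ENNReal.ofReal_mul (by positivity),
          Real.mul_rpow (by positivity) hε.le, Real.rpow_add hε, Real.rpow_natCast]
        congr 2
        field_simp

end CellMeans

section Hat

/-- The one-dimensional hat function, whose products are the `Q₁` basis functions. -/
noncomputable def hat (t : ℝ) : ℝ := max 0 (1 - |t|)

theorem hat_nonneg (t : ℝ) : 0 ≤ hat t := le_max_left _ _

theorem hat_le_one (t : ℝ) : hat t ≤ 1 := max_le zero_le_one (by linarith [abs_nonneg t])

theorem abs_hat_le_one (t : ℝ) : |hat t| ≤ 1 := by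
  rw [abs_of_nonneg (hat_nonneg t)]
  exact hat_le_one t

theorem hat_of_mem_Icc {t : ℝ} (ht : t ∈ Icc (0 : ℝ) 1) : hat t = 1 - t := by
  rw [hat, abs_of_nonneg ht.1, max_eq_right (sub_nonneg.2 ht.2)]

theorem hat_neg (t : ℝ) : hat (-t) = hat t := by rw [hat, abs_neg, hat]

theorem abs_hat_sub_hat_le (t t' : ℝ) : |hat t - hat t'| ≤ |t - t'| := by
  calc |hat t - hat t'| ≤ max |(0 : ℝ) - 0| |(1 - |t|) - (1 - |t'|)| :=
        abs_max_sub_max_le_max _ _ _ _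
    _ = |(|t'| - |t|)| := by simp
    _ ≤ |t' - t| := abs_abs_sub_abs_le _ _
    _ = |t - t'| := abs_sub_comm _ _

theorem hat_sub_intCast_eq_zero {t : ℝ} {k : ℤ} (h0 : k ≠ ⌊t⌋) (h1 : k ≠ ⌊t⌋ + 1) :
    hat (t - k) = 0 := by
  have hfar : 1 ≤ |t - k| := by
    rw [le_abs]
    rcases lt_or_gt_of_ne h0 with h | h
    · have hle : ((k + 1 : ℤ) : ℝ) ≤ t := (Int.cast_le.2 (by omega)).trans (Int.floor_le t)
      push_cast at hle
      exact Or.inl (by linarith)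
    · have hle : ((⌊t⌋ + 2 : ℤ) : ℝ) ≤ k := Int.cast_le.2 (by omega)
      push_cast at hle
      exact Or.inr (by linarith [Int.lt_floor_add_one t])
  rw [hat, max_eq_left (by linarith)]

theorem abs_prod_sub_prod_le_sum {ι : Type*} (S : Finset ι) {a b : ι → ℝ}
    (ha : ∀ i, |a i| ≤ 1) (hb : ∀ i, |b i| ≤ 1) :
    |∏ i ∈ S, a i - ∏ i ∈ S, b i| ≤ ∑ i ∈ S, |a i - b i| := by
  classical
  induction S using Finset.induction_on with
  | empty => simp
  | insert j S hj ih =>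
    rw [Finset.prod_insert hj, Finset.prod_insert hj, Finset.sum_insert hj]
    have hprod : |∏ i ∈ S, a i| ≤ 1 := by
      rw [Finset.abs_prod]
      exact Finset.prod_le_one (fun i _ => abs_nonneg _) fun i _ => ha i
    calc |a j * ∏ i ∈ S, a i - b j * ∏ i ∈ S, b i|
        = |(a j - b j) * ∏ i ∈ S, a i + b j * (∏ i ∈ S, a i - ∏ i ∈ S, b i)| := by ring_nf
      _ ≤ |a j - b j| * |∏ i ∈ S, a i| + |b j| * |∏ i ∈ S, a i - ∏ i ∈ S, b i| := by
          rw [← abs_mul, ← abs_mul]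
          exact abs_add_le _ _
      _ ≤ |a j - b j| + ∑ i ∈ S, |a i - b i| :=
          add_le_add (mul_le_of_le_one_right (abs_nonneg _) hprod)
            ((mul_le_of_le_one_left (abs_nonneg _) (hb j)).trans ih)

end Hat

section Interpolation

variable {n : ℕ} {ε : ℝ}

/-- The `Q₁` basis function of the node `εξ`: it is `1` at that node and `0` at the others. -/
noncomputable def nodeFun (ε : ℝ) (ξ : Fin n → ℤ) (x : Rn n) : ℝ :=
  ∏ i, hat (ε⁻¹ * x i - ξ i)

theorem nodeFun_nonneg (ε : ℝ) (ξ : Fin n → ℤ) (x : Rn n) : 0 ≤ nodeFun ε ξ x :=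
  Finset.prod_nonneg fun _ _ => hat_nonneg _

theorem nodeFun_le_one (ε : ℝ) (ξ : Fin n → ℤ) (x : Rn n) : nodeFun ε ξ x ≤ 1 :=
  Finset.prod_le_one (fun _ _ => hat_nonneg _) fun _ _ => hat_le_one _

theorem nodeFun_vertex (ε : ℝ) (x : Rn n) (κ : Fin n → Fin 2) :
    nodeFun ε (vertex ε x κ) x =
      ∏ i, if κ i = 1 then Int.fract (ε⁻¹ * x i) else 1 - Int.fract (ε⁻¹ * x i) := by
  refine Finset.prod_congr rfl fun i _ => ?_
  have hfract := Int.fract_nonneg (ε⁻¹ * x i)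
  have hfract' := (Int.fract_lt_one (ε⁻¹ * x i)).le
  have hsub : ε⁻¹ * x i - vertex ε x κ i = Int.fract (ε⁻¹ * x i) - ((κ i : ℕ) : ℝ) := by
    simp only [vertex, intPart, PiLp.smul_apply, smul_eq_mul, Int.cast_add, Int.cast_natCast]
    linarith [Int.floor_add_fract (ε⁻¹ * x i)]
  rw [hsub]
  rcases Fin.exists_fin_two.1 ⟨κ i, rfl⟩ with h | h
  · simpa [h] using hat_of_mem_Icc ⟨hfract, hfract'⟩
  · rw [← hat_neg, hat_of_mem_Icc (by simp [h, hfract, hfract'])]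
    simp [h]

theorem sum_nodeFun_vertex (ε : ℝ) (x : Rn n) : ∑ κ, nodeFun ε (vertex ε x κ) x = 1 := by
  have hexpand := Finset.prod_univ_sum (fun _ : Fin n => (Finset.univ : Finset (Fin 2)))
    (fun i j => if j = 1 then Int.fract (ε⁻¹ * x i) else 1 - Int.fract (ε⁻¹ * x i))
  simp_rw [nodeFun_vertex, ← Fintype.piFinset_univ, ← hexpand]
  exact Finset.prod_eq_one fun i _ => by simp

theorem q1Interp_eq_sum_vertex (ε : ℝ) (u : Rn n → ℝ) (x : Rn n) :
    q1Interp ε u x = ∑ κ, cellMean ε u (vertex ε x κ) * nodeFun ε (vertex ε x κ) x := by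
  simp_rw [nodeFun_vertex]
  rfl

theorem sub_q1Interp_eq_sum (ε : ℝ) (u : Rn n → ℝ) (x : Rn n) (a : ℝ) :
    a - q1Interp ε u x =
      ∑ κ, nodeFun ε (vertex ε x κ) x * (a - cellMean ε u (vertex ε x κ)) := by
  simp_rw [mul_sub, Finset.sum_sub_distrib, ← Finset.sum_mul, sum_nodeFun_vertex, one_mul,
    q1Interp_eq_sum_vertex, mul_comm]

theorem sq_sub_q1Interp_le (ε : ℝ) (u : Rn n → ℝ) (x : Rn n) (a : ℝ) :
    (a - q1Interp ε u x) ^ 2 ≤ ∑ κ, (a - cellMean ε u (vertex ε x κ)) ^ 2 := by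
  calc (a - q1Interp ε u x) ^ 2
      ≤ ∑ κ, nodeFun ε (vertex ε x κ) x * (a - cellMean ε u (vertex ε x κ)) ^ 2 := by
        rw [sub_q1Interp_eq_sum]
        exact Real.pow_arith_mean_le_arith_mean_pow_of_even Finset.univ _ _
          (fun κ _ => nodeFun_nonneg ε _ x) (sum_nodeFun_vertex ε x) even_two
    _ ≤ ∑ κ, (a - cellMean ε u (vertex ε x κ)) ^ 2 :=
        Finset.sum_le_sum fun κ _ =>
          mul_le_of_le_one_left (sq_nonneg _) (nodeFun_le_one ε _ x)

theorem sum_ofReal_sq_sub_cellMean_vertex_le (hε : 0 < ε) {u : Rn n → ℝ} (hu : AEMeasurable u)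
    (x : Rn n) (a : ℝ) :
    ∑ κ, ENNReal.ofReal ((a - cellMean ε u (vertex ε x κ)) ^ 2) ≤
      ENNReal.ofReal (2 ^ n * (ε ^ n)⁻¹) *
        ∫⁻ y in closedBall x (2 * √n * ε), ENNReal.ofReal ((a - u y) ^ 2) := by
  refine (Finset.sum_le_sum fun κ _ =>
    ofReal_sq_sub_cellMean_vertex_le hε hu x κ a).trans_eq ?_
  simp [ENNReal.ofReal_mul, ENNReal.ofReal_pow, mul_assoc]

theorem ofReal_sq_sub_q1Interp_le (hε : 0 < ε) {u : Rn n → ℝ} (hu : AEMeasurable u) (x : Rn n)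
    (a : ℝ) :
    ENNReal.ofReal ((a - q1Interp ε u x) ^ 2) ≤ ENNReal.ofReal (2 ^ n * (ε ^ n)⁻¹) *
      ∫⁻ y in closedBall x (2 * √n * ε), ENNReal.ofReal ((a - u y) ^ 2) := by
  refine (ENNReal.ofReal_le_ofReal (sq_sub_q1Interp_le ε u x a)).trans ?_
  rw [ENNReal.ofReal_sum_of_nonneg fun κ _ => sq_nonneg _]
  exact sum_ofReal_sq_sub_cellMean_vertex_le hε hu x a

variable {s : ℝ}

theorem exists_eLpNorm_sub_cellAverage_le (n : ℕ) (hs : 0 ≤ s) :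
    ∃ C : ℝ≥0, ∀ ε : ℝ, 0 < ε → ∀ u : Rn n → ℝ, AEMeasurable u →
      eLpNorm (fun x => u x - cellAverage ε u x) 2 volume ≤
        ENNReal.ofReal (C * ε ^ s) * hsNorm s univ u := by
  refine ⟨⟨√(1 * (2 * √n) ^ ((n : ℝ) + 2 * s)), Real.sqrt_nonneg _⟩, fun ε hε u hu => ?_⟩
  refine eLpNorm_le_hsNorm_of_lintegral_sq_le (by positivity) hε.le
    (lintegral_le_of_le_ballOscillation hs hε zero_le_one fun x => ?_)
  rw [Real.norm_eq_abs, sq_abs, one_mul, cellAverage_eq_cellMean_vertex]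
  exact ofReal_sq_sub_cellMean_vertex_le hε hu x 0 (u x)

theorem exists_eLpNorm_sub_q1Interp_le (n : ℕ) (hs : 0 ≤ s) :
    ∃ C : ℝ≥0, ∀ ε : ℝ, 0 < ε → ∀ u : Rn n → ℝ, AEMeasurable u →
      eLpNorm (fun x => u x - q1Interp ε u x) 2 volume ≤
        ENNReal.ofReal (C * ε ^ s) * hsNorm s univ u := by
  refine ⟨⟨√(2 ^ n * (2 * √n) ^ ((n : ℝ) + 2 * s)), Real.sqrt_nonneg _⟩, fun ε hε u hu => ?_⟩
  refine eLpNorm_le_hsNorm_of_lintegral_sq_le (by positivity) hε.le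
    (lintegral_le_of_le_ballOscillation hs hε (c := 2 ^ n) (by positivity) fun x => ?_)
  rw [Real.norm_eq_abs, sq_abs]
  exact ofReal_sq_sub_q1Interp_le hε hu x (u x)

end Interpolation

section InterpolationGradient

variable {n : ℕ} {ε : ℝ}

theorem abs_nodeFun_sub_le (hε : 0 < ε) (ξ : Fin n → ℤ) (x y : Rn n) :
    |nodeFun ε ξ x - nodeFun ε ξ y| ≤ n * ε⁻¹ * ‖x - y‖ := by
  have hcoord : ∀ i ∈ (Finset.univ : Finset (Fin n)),
      |hat (ε⁻¹ * x i - ξ i) - hat (ε⁻¹ * y i - ξ i)| ≤ ε⁻¹ * ‖x - y‖ := by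
    intro i _
    calc |hat (ε⁻¹ * x i - ξ i) - hat (ε⁻¹ * y i - ξ i)|
        ≤ |ε⁻¹ * x i - ξ i - (ε⁻¹ * y i - ξ i)| := abs_hat_sub_hat_le _ _
      _ = ε⁻¹ * ‖(x - y) i‖ := by
          rw [sub_sub_sub_cancel_right, ← mul_sub, abs_mul, abs_of_pos (inv_pos.2 hε),
            Real.norm_eq_abs, PiLp.sub_apply]
      _ ≤ ε⁻¹ * ‖x - y‖ := by
          gcongr
          exact PiLp.norm_apply_le (x - y) i
  calc |nodeFun ε ξ x - nodeFun ε ξ y|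
      ≤ ∑ i, |hat (ε⁻¹ * x i - ξ i) - hat (ε⁻¹ * y i - ξ i)| :=
        abs_prod_sub_prod_le_sum _ (fun _ => abs_hat_le_one _) fun _ => abs_hat_le_one _
    _ ≤ n * ε⁻¹ * ‖x - y‖ := by
        refine (Finset.sum_le_card_nsmul _ _ _ hcoord).trans_eq ?_
        rw [Finset.card_univ, Fintype.card_fin, nsmul_eq_mul, mul_assoc]

theorem nodeFun_eq_zero_of_notMem_range_vertex {ξ : Fin n → ℤ} {x : Rn n}
    (hξ : ξ ∉ range (vertex ε x)) : nodeFun ε ξ x = 0 := by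
  obtain ⟨i, hfloor, hfloor'⟩ : ∃ i, ξ i ≠ ⌊ε⁻¹ * x i⌋ ∧ ξ i ≠ ⌊ε⁻¹ * x i⌋ + 1 := by
    by_contra! hcon
    refine hξ ⟨fun i => if ξ i = ⌊ε⁻¹ * x i⌋ then 0 else 1, funext fun i => ?_⟩
    by_cases hi : ξ i = ⌊ε⁻¹ * x i⌋
    · simp [vertex, intPart, hi]
    · simp [vertex, intPart, hcon i hi]
  exact Finset.prod_eq_zero (Finset.mem_univ i) (hat_sub_intCast_eq_zero hfloor hfloor')

theorem q1Interp_eq_sum_nodeFun (u : Rn n → ℝ) {x : Rn n} {S : Finset (Fin n → ℤ)}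
    (hS : ∀ κ, vertex ε x κ ∈ S) :
    q1Interp ε u x = ∑ ξ ∈ S, cellMean ε u ξ * nodeFun ε ξ x := by
  classical
  calc q1Interp ε u x
      = ∑ ξ ∈ Finset.univ.image (vertex ε x), cellMean ε u ξ * nodeFun ε ξ x := by
        rw [q1Interp_eq_sum_vertex, Finset.sum_image (vertex_injective ε x).injOn]
    _ = ∑ ξ ∈ S, cellMean ε u ξ * nodeFun ε ξ x := by
        refine Finset.sum_subset ?_ fun ξ _ hξ => ?_
        · simpa only [Finset.image_subset_iff, Finset.mem_univ, forall_const] using hS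
        · rw [nodeFun_eq_zero_of_notMem_range_vertex (by simpa using hξ), mul_zero]

theorem exists_finset_forall_vertex_mem (hε : 0 < ε) (R : ℝ) :
    ∃ S : Finset (Fin n → ℤ), ∀ x ∈ ball (0 : Rn n) R, ∀ κ, vertex ε x κ ∈ S := by
  refine ⟨Fintype.piFinset fun _ => Finset.Icc (-⌈ε⁻¹ * R⌉) (⌈ε⁻¹ * R⌉ + 1), fun x hx κ => ?_⟩
  rw [mem_ball_zero_iff] at hx
  rw [Fintype.mem_piFinset]
  intro i
  have habs : |ε⁻¹ * x i| ≤ ⌈ε⁻¹ * R⌉ := by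
    rw [abs_mul, abs_of_pos (inv_pos.2 hε)]
    refine le_trans ?_ (Int.le_ceil _)
    gcongr
    exact (PiLp.norm_apply_le x i).trans hx.le
  have hupper : ⌊ε⁻¹ * x i⌋ ≤ ⌈ε⁻¹ * R⌉ :=
    Int.cast_le.1 ((Int.floor_le _).trans (abs_le.1 habs).2)
  have hlower : -⌈ε⁻¹ * R⌉ ≤ ⌊ε⁻¹ * x i⌋ := by
    rw [Int.le_floor, Int.cast_neg]
    exact (abs_le.1 habs).1
  have hκ : (κ i : ℕ) ≤ 1 := Nat.lt_succ_iff.1 (κ i).2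
  simp only [vertex, intPart, PiLp.smul_apply, smul_eq_mul, Finset.mem_Icc]
  omega

theorem exists_lipschitzWith_eqOn_q1Interp (hε : 0 < ε) (u : Rn n → ℝ) (R : ℝ) :
    ∃ (C : ℝ≥0) (g : Rn n → ℝ), LipschitzWith C g ∧ EqOn (q1Interp ε u) g (ball 0 R) := by
  obtain ⟨S, hS⟩ := exists_finset_forall_vertex_mem (n := n) hε R
  refine ⟨Real.toNNReal ((∑ ξ ∈ S, |cellMean ε u ξ|) * (n * ε⁻¹)),
    fun x => ∑ ξ ∈ S, cellMean ε u ξ * nodeFun ε ξ x, ?_,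
    fun x hx => q1Interp_eq_sum_nodeFun u (hS x hx)⟩
  refine LipschitzWith.of_dist_le_mul fun x y => ?_
  rw [Real.coe_toNNReal _ (by positivity), Real.dist_eq, ← Finset.sum_sub_distrib, dist_eq_norm,
    Finset.sum_mul, Finset.sum_mul]
  refine (Finset.abs_sum_le_sum_abs _ _).trans (Finset.sum_le_sum fun ξ _ => ?_)
  rw [← mul_sub, abs_mul, mul_assoc]
  gcongr
  exact abs_nodeFun_sub_le hε ξ x y

theorem continuous_q1Interp (hε : 0 < ε) (u : Rn n → ℝ) : Continuous (q1Interp ε u) := by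
  refine continuous_iff_continuousAt.2 fun x => ?_
  obtain ⟨C, g, hg, heq⟩ := exists_lipschitzWith_eqOn_q1Interp hε u (‖x‖ + 1)
  have hx : ball (0 : Rn n) (‖x‖ + 1) ∈ nhds x := isOpen_ball.mem_nhds (by simp)
  exact hg.continuous.continuousAt.congr (heq.symm.eventuallyEq_of_mem hx)

/-- The vector of the partial derivatives of `𝒬_ε(u)`, which exist almost everywhere. -/
noncomputable def q1Gradient (ε : ℝ) (u : Rn n → ℝ) (x : Rn n) : Rn n :=
  WithLp.toLp 2 fun i => lineDeriv ℝ (q1Interp ε u) x (EuclideanSpace.single i 1)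

theorem measurable_q1Gradient (hε : 0 < ε) (u : Rn n → ℝ) : Measurable (q1Gradient ε u) := by
  refine (PiLp.volume_preserving_toLp (Fin n)).measurable.comp
    (measurable_pi_lambda _ fun i => ?_)
  exact measurable_lineDeriv (continuous_q1Interp hε u)

theorem abs_q1Interp_sub_le (hε : 0 < ε) (u : Rn n → ℝ) {x y : Rn n}
    (hxy : vertex ε y = vertex ε x) (a : ℝ) :
    |q1Interp ε u y - q1Interp ε u x| ≤
      n * ε⁻¹ * (∑ κ, |a - cellMean ε u (vertex ε x κ)|) * ‖y - x‖ := by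
  have hdiff : q1Interp ε u y - q1Interp ε u x =
      ∑ κ, (nodeFun ε (vertex ε x κ) x - nodeFun ε (vertex ε x κ) y) *
        (a - cellMean ε u (vertex ε x κ)) := by
    have hx := sub_q1Interp_eq_sum ε u x a
    have hy := sub_q1Interp_eq_sum ε u y a
    rw [hxy] at hy
    simp_rw [sub_mul, Finset.sum_sub_distrib]
    linarith
  rw [hdiff, mul_right_comm, Finset.mul_sum]
  refine (Finset.abs_sum_le_sum_abs _ _).trans (Finset.sum_le_sum fun κ _ => ?_)
  rw [abs_mul, norm_sub_rev]
  gcongr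
  exact abs_nodeFun_sub_le hε _ _ _

theorem eventually_floor_add_mul_eq (a : ℝ) {b : ℝ} (hb : 0 ≤ b) :
    ∀ᶠ t in nhdsWithin (0 : ℝ) (Ioi 0), ⌊a + t * b⌋ = ⌊a⌋ := by
  have hlt : ∀ᶠ t in nhds (0 : ℝ), a + t * b < ⌊a⌋ + 1 :=
    (by fun_prop : Continuous fun t : ℝ => a + t * b).continuousAt.eventually_lt
      continuousAt_const (by simp)
  filter_upwards [nhdsWithin_le_nhds hlt, self_mem_nhdsWithin] with t ht ht0
  have hpos : 0 ≤ t * b := mul_nonneg (le_of_lt ht0) hb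
  exact Int.floor_eq_iff.2 ⟨by linarith [Int.floor_le a], ht⟩

theorem eventually_vertex_add_smul_single_eq (hε : 0 < ε) (x : Rn n) (i : Fin n) :
    ∀ᶠ t in nhdsWithin (0 : ℝ) (Ioi 0),
      vertex ε (x + t • EuclideanSpace.single i 1) = vertex ε x := by
  have hcoord : ∀ j, ∀ᶠ t in nhdsWithin (0 : ℝ) (Ioi 0),
      ⌊ε⁻¹ * x j + t * (ε⁻¹ * (EuclideanSpace.single i (1 : ℝ) : Rn n) j)⌋ = ⌊ε⁻¹ * x j⌋ := by
    refine fun j => eventually_floor_add_mul_eq _ (mul_nonneg (inv_pos.2 hε).le ?_)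
    rw [PiLp.single_apply]
    split_ifs <;> norm_num
  filter_upwards [Filter.eventually_all.2 hcoord] with t ht
  ext κ j
  simp only [vertex, intPart, PiLp.smul_apply, PiLp.add_apply, smul_eq_mul, ← ht j]
  ring_nf

/-- A one-sided difference quotient suffices, so that the points stay in the cell of `x`. -/
theorem abs_lineDeriv_q1Interp_le (hε : 0 < ε) (u : Rn n → ℝ) (x : Rn n) (a : ℝ) (i : Fin n) :
    |lineDeriv ℝ (q1Interp ε u) x (EuclideanSpace.single i 1)| ≤
      n * ε⁻¹ * ∑ κ, |a - cellMean ε u (vertex ε x κ)| := by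
  by_cases hdiff : LineDifferentiableAt ℝ (q1Interp ε u) x (EuclideanSpace.single i 1)
  swap
  · rw [lineDeriv_zero_of_not_lineDifferentiableAt hdiff, abs_zero]
    positivity
  refine le_of_tendsto hdiff.hasLineDerivAt.tendsto_slope_zero_right.abs ?_
  filter_upwards [eventually_vertex_add_smul_single_eq hε x i, self_mem_nhdsWithin]
    with t hvertex (ht : 0 < t)
  rw [smul_eq_mul, abs_mul, abs_of_pos (inv_pos.2 ht), inv_mul_le_iff₀ ht]
  refine (abs_q1Interp_sub_le hε u hvertex a).trans_eq ?_
  rw [add_sub_cancel_left, norm_smul, PiLp.norm_single, norm_one, mul_one,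
    Real.norm_of_nonneg ht.le, mul_comm]

theorem norm_q1Gradient_sq_le (hε : 0 < ε) (u : Rn n → ℝ) (x : Rn n) (a : ℝ) :
    ‖q1Gradient ε u x‖ ^ 2 ≤
      n * (n * ε⁻¹) ^ 2 * 2 ^ n * ∑ κ, (a - cellMean ε u (vertex ε x κ)) ^ 2 := by
  calc ‖q1Gradient ε u x‖ ^ 2
      ≤ (√n * (n * ε⁻¹ * ∑ κ, |a - cellMean ε u (vertex ε x κ)|)) ^ 2 := by
        gcongr
        exact norm_le_sqrt_mul_of_abs_le (by positivity)
          fun i => abs_lineDeriv_q1Interp_le hε u x a i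
    _ = n * (n * ε⁻¹) ^ 2 * (∑ κ, |a - cellMean ε u (vertex ε x κ)|) ^ 2 := by
        rw [mul_pow, mul_pow, Real.sq_sqrt n.cast_nonneg, mul_assoc]
    _ ≤ n * (n * ε⁻¹) ^ 2 * (2 ^ n * ∑ κ, (a - cellMean ε u (vertex ε x κ)) ^ 2) := by
        gcongr
        refine sq_sum_le_card_mul_sum_sq.trans_eq ?_
        simp
    _ = _ := by ring

theorem ofReal_norm_q1Gradient_sq_le (hε : 0 < ε) {u : Rn n → ℝ} (hu : AEMeasurable u)
    (x : Rn n) :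
    ENNReal.ofReal (‖q1Gradient ε u x‖ ^ 2) ≤
      ENNReal.ofReal (n * (n * ε⁻¹) ^ 2 * 2 ^ n * 2 ^ n * (ε ^ n)⁻¹) *
        ballOscillation u (2 * √n * ε) x := by
  calc ENNReal.ofReal (‖q1Gradient ε u x‖ ^ 2)
      ≤ ENNReal.ofReal (n * (n * ε⁻¹) ^ 2 * 2 ^ n) *
          ∑ κ, ENNReal.ofReal ((u x - cellMean ε u (vertex ε x κ)) ^ 2) := by
        rw [← ENNReal.ofReal_sum_of_nonneg fun κ _ => sq_nonneg _,
          ← ENNReal.ofReal_mul (by positivity)]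
        exact ENNReal.ofReal_le_ofReal (norm_q1Gradient_sq_le hε u x (u x))
    _ ≤ ENNReal.ofReal (n * (n * ε⁻¹) ^ 2 * 2 ^ n) *
          (ENNReal.ofReal (2 ^ n * (ε ^ n)⁻¹) * ballOscillation u (2 * √n * ε) x) := by
        gcongr
        exact sum_ofReal_sq_sub_cellMean_vertex_le hε hu x (u x)
    _ = _ := by
        rw [← mul_assoc, ← ENNReal.ofReal_mul (by positivity), ← mul_assoc]

theorem exists_eLpNorm_q1Gradient_le (n : ℕ) {s : ℝ} (hs : 0 ≤ s) :
    ∃ C : ℝ≥0, ∀ ε : ℝ, 0 < ε → ∀ u : Rn n → ℝ, AEMeasurable u →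
      eLpNorm (q1Gradient ε u) 2 volume ≤
        ENNReal.ofReal (C * ε ^ (s - 1)) * hsNorm s univ u := by
  refine ⟨⟨√(n * n ^ 2 * 2 ^ n * 2 ^ n * (2 * √n) ^ ((n : ℝ) + 2 * s)), Real.sqrt_nonneg _⟩,
    fun ε hε u hu => ?_⟩
  refine eLpNorm_le_hsNorm_of_lintegral_sq_le (by positivity) hε.le ?_
  refine (lintegral_le_of_le_ballOscillation hs hε (by positivity)
    (ofReal_norm_q1Gradient_sq_le hε hu)).trans_eq ?_
  rw [mul_sub_one, Real.rpow_sub hε, Real.rpow_two]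
  congr 2
  field_simp

theorem integral_q1Interp_mul_lineDeriv_eq (hε : 0 < ε) (u : Rn n → ℝ) {ψ : Rn n → ℝ}
    (hψ : ContDiff ℝ ∞ ψ) (hψc : HasCompactSupport ψ) (e : Rn n) :
    ∫ x, q1Interp ε u x * fderiv ℝ ψ x e = -∫ x, lineDeriv ℝ (q1Interp ε u) x e * ψ x := by
  obtain ⟨R, hR⟩ := hψc.isCompact.isBounded.subset_ball (0 : Rn n)
  obtain ⟨C, g, hg, heq⟩ := exists_lipschitzWith_eqOn_q1Interp hε u R
  obtain ⟨D, hD⟩ := ContDiff.lipschitzWith_of_hasCompactSupport hψc hψ (by simp)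
  have hleft : ∫ x, q1Interp ε u x * fderiv ℝ ψ x e = -∫ x, lineDeriv ℝ ψ x (-e) * g x := by
    rw [← integral_neg]
    congr with x
    rw [lineDeriv_neg, (hψ.differentiable (by simp) x).lineDeriv_eq_fderiv]
    by_cases hx : x ∈ tsupport ψ
    · rw [heq (hR hx)]
      ring
    · have hzero : fderiv ℝ ψ x = 0 :=
        Function.notMem_support.1 fun h => hx (support_fderiv_subset ℝ h)
      simp [hzero]
  have hright : ∫ x, lineDeriv ℝ (q1Interp ε u) x e * ψ x = ∫ x, lineDeriv ℝ g x e * ψ x := by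
    congr with x
    by_cases hx : x ∈ tsupport ψ
    · rw [(heq.eventuallyEq_of_mem (isOpen_ball.mem_nhds (hR hx))).lineDeriv_eq]
    · rw [image_eq_zero_of_notMem_tsupport hx, mul_zero, mul_zero]
  rw [hleft, hright, ← hg.integral_lineDeriv_mul_eq hD hψc]

theorem hasWeakGradientOn_q1Interp (hε : 0 < ε) {u : Rn n → ℝ} (U : Set (Rn n))
    (hG : eLpNorm (q1Gradient ε u) 2 volume < ⊤) :
    HasWeakGradientOn U (q1Interp ε u) (q1Gradient ε u) := by
  have hmem : MemLp (q1Gradient ε u) 2 volume :=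
    ⟨(measurable_q1Gradient hε u).aestronglyMeasurable, hG⟩
  refine ⟨(continuous_q1Interp hε u).locallyIntegrable.locallyIntegrableOn U,
    (hmem.locallyIntegrable one_le_two).locallyIntegrableOn U, fun ψ hψ hψc hψU i => ?_⟩
  have hψ_zero : ∀ x ∉ U, ψ x = 0 := fun x hx =>
    image_eq_zero_of_notMem_tsupport fun h => hx (hψU h)
  have hfderiv_zero : ∀ x ∉ U, fderiv ℝ ψ x = 0 := fun x hx =>
    Function.notMem_support.1 fun h => hx (hψU (support_fderiv_subset ℝ h))
  rw [setIntegral_eq_integral_of_forall_compl_eq_zero fun x hx => by simp [hfderiv_zero x hx],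
    setIntegral_eq_integral_of_forall_compl_eq_zero fun x hx => by simp [hψ_zero x hx]]
  exact integral_q1Interp_mul_lineDeriv_eq hε u hψ hψc _

theorem exists_hasWeakGradientOn_q1Interp_eLpNorm_le (n : ℕ) {s : ℝ} (hs : 0 ≤ s) :
    ∃ C : ℝ≥0, ∀ ε : ℝ, 0 < ε → ∀ u : Rn n → ℝ, MemHs s univ u → ∀ U : Set (Rn n),
      ∃ G : Rn n → Rn n, HasWeakGradientOn U (q1Interp ε u) G ∧
        eLpNorm G 2 (volume.restrict U) ≤ ENNReal.ofReal (C * ε ^ (s - 1)) * hsNorm s univ u := by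
  obtain ⟨C, hC⟩ := exists_eLpNorm_q1Gradient_le n hs
  refine ⟨C, fun ε hε u hu U => ?_⟩
  have hle : eLpNorm (q1Gradient ε u) 2 volume ≤
      ENNReal.ofReal (C * ε ^ (s - 1)) * hsNorm s univ u :=
    hC ε hε u (by simpa only [Measure.restrict_univ] using hu.1.aemeasurable)
  exact ⟨q1Gradient ε u,
    hasWeakGradientOn_q1Interp hε U
      (hle.trans_lt (ENNReal.mul_lt_top ENNReal.ofReal_lt_top hu.2)),
    (eLpNorm_mono_measure _ Measure.restrict_le_self).trans hle⟩

end InterpolationGradient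

section Heights

variable {n : ℕ}

/-- A Lipschitz function growing at unit rate along a unit vector `dir`; its zero set is a
Lipschitz graph over `dirᗮ`, and it measures the signed vertical distance to that graph. -/
structure Height (n : ℕ) where
  toFun : Rn n → ℝ
  dir : Rn n
  lip : ℝ≥0
  norm_dir : ‖dir‖ = 1
  lipschitz : LipschitzWith lip toFun
  add_smul : ∀ (y : Rn n) (t : ℝ), toFun (y + t • dir) = toFun y + t

namespace Height

instance : CoeFun (Height n) fun _ => Rn n → ℝ := ⟨toFun⟩

/-- The height above the graph of `γ` in the direction `e`, with the conventions of
`HasLipschitzBoundary`. -/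
noncomputable def ofGraph (e : Rn n) (he : ‖e‖ = 1) {γ : Rn n → ℝ} {L : ℝ≥0}
    (hγ : LipschitzWith L γ) : Height n where
  toFun y := ⟪e, y⟫ - γ (y - ⟪e, y⟫ • e)
  dir := e
  lip := 1 + L * (1 + 1)
  norm_dir := he
  lipschitz := by
    have hinner : LipschitzWith 1 fun y : Rn n => ⟪e, y⟫ := by
      have hnorm : ‖innerSL ℝ e‖₊ = 1 := NNReal.eq ((innerSL_apply_norm ℝ e).trans he)
      exact hnorm ▸ (innerSL ℝ e).lipschitz
    have hsmul : LipschitzWith 1 fun y : Rn n => ⟪e, y⟫ • e := by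
      refine LipschitzWith.of_dist_le_mul fun x y => ?_
      rw [dist_eq_norm, ← sub_smul, norm_smul, he, mul_one, ← dist_eq_norm]
      exact hinner.dist_le_mul x y
    exact hinner.sub (hγ.comp (LipschitzWith.id.sub hsmul))
  add_smul y t := by
    have hinner : ⟪e, y + t • e⟫ = ⟪e, y⟫ + t := by
      rw [inner_add_right, inner_smul_right, real_inner_self_eq_norm_sq, he]; ring
    have hproj : y + t • e - (⟪e, y⟫ + t) • e = y - ⟪e, y⟫ • e := by module
    rw [hinner, hproj]
    ring

/-- The height above the graph translated by `-c` in the vertical direction. -/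
noncomputable def addConst (h : Height n) (c : ℝ) : Height n where
  toFun y := h y + c
  dir := h.dir
  lip := h.lip
  norm_dir := h.norm_dir
  lipschitz := by simpa using h.lipschitz.add (LipschitzWith.const c)
  add_smul y t := by rw [h.add_smul]; ring

theorem continuous (h : Height n) : Continuous h := h.lipschitz.continuous

theorem measurable (h : Height n) : Measurable h := h.continuous.measurable

end Height

/-- A neighbourhood of `x` in which `Ω` is the positivity set of a height function. -/
structure BoundaryChart (Ω : Set (Rn n)) (x : Rn n) where
  height : Height n
  radius : ℝ
  pos : 0 < radius
  mem_iff : ∀ y ∈ ball x radius, y ∈ Ω ↔ 0 < height y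

theorem HasLipschitzBoundary.nonempty_boundaryChart {Ω : Set (Rn n)} (hΩ : HasLipschitzBoundary Ω)
    {x : Rn n} (hx : x ∈ frontier Ω) : Nonempty (BoundaryChart Ω x) := by
  obtain ⟨e, γ, L, r, he, hγ, hr, hmem⟩ := hΩ x hx
  exact ⟨.ofGraph e he hγ, r, hr, fun y hy => (hmem y hy).trans sub_pos.symm⟩

theorem BoundaryChart.eq_zero_of_mem_frontier {Ω : Set (Rn n)} (hΩ : IsOpen Ω) {x z : Rn n}
    (c : BoundaryChart Ω x) (hz : z ∈ frontier Ω) (hzc : z ∈ ball x c.radius) :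
    c.height z = 0 := by
  rw [hΩ.frontier_eq] at hz
  refine le_antisymm (not_lt.1 fun hlt => hz.2 ((c.mem_iff z hzc).2 hlt)) ?_
  have hnonneg : closure (ball x c.radius ∩ Ω) ⊆ {y | 0 ≤ c.height y} :=
    closure_minimal (fun y hy => ((c.mem_iff y hy.1).1 hy.2).le)
      (isClosed_le continuous_const c.height.continuous)
  exact hnonneg (isOpen_ball.inter_closure ⟨hzc, hz.1⟩)

theorem isCompact_frontier_of_isBounded {Ω : Set (Rn n)} (hΩ : Bornology.IsBounded Ω) :
    IsCompact (frontier Ω) :=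
  isCompact_of_isClosed_isBounded isClosed_frontier (hΩ.closure.subset frontier_subset_closure)

theorem exists_finite_heights {Ω : Set (Rn n)} (hΩ : IsOpen Ω) (hΩ_bdd : Bornology.IsBounded Ω)
    (hΩ_lip : HasLipschitzBoundary Ω) :
    ∃ (ι : Type) (_ : Fintype ι) (h : ι → Height n), frontier Ω ⊆ ⋃ i, {y | h i y = 0} := by
  have c (x : frontier Ω) : BoundaryChart Ω (x : Rn n) :=
    Classical.choice (hΩ_lip.nonempty_boundaryChart x.2)
  obtain ⟨t, ht⟩ := (isCompact_frontier_of_isBounded hΩ_bdd).elim_finite_subcover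
    (fun x : frontier Ω => ball (x : Rn n) (c x).radius) (fun _ => isOpen_ball)
    fun x hx => mem_iUnion.2 ⟨⟨x, hx⟩, mem_ball_self (c _).pos⟩
  refine ⟨t, inferInstance, fun x => (c x).height, fun z hz => ?_⟩
  obtain ⟨x, hxt, hzx⟩ := mem_iUnion₂.1 (ht hz)
  exact mem_iUnion.2 ⟨⟨x, hxt⟩, (c x).eq_zero_of_mem_frontier hΩ hz hzx⟩

end Heights

section Strips

variable {n : ℕ} {s : ℝ}

theorem doubling_constant_bound {s q : ℝ} (hq1 : q * 2 ^ s < 1) (c : ℝ) :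
    q * (2 ^ s + c / (1 - q * 2 ^ s)) * 2 ^ s + c ≤ 2 ^ s + c / (1 - q * 2 ^ s) := by
  have hden : 0 < 1 - q * 2 ^ s := by linarith
  have h2s : (0 : ℝ) < 2 ^ s := by positivity
  have hc' : c = c / (1 - q * 2 ^ s) * (1 - q * 2 ^ s) := by field_simp
  nlinarith [mul_pos h2s hden]

theorem le_of_doubling_recursion {q c : ℝ} (hs : 0 < s) (hq : 0 < q) (hq1 : q * 2 ^ s < 1)
    (hc : 0 ≤ c) {G : ℝ → ℝ} {E : ℝ} (hE : 0 ≤ E) (hGE : ∀ w, 0 < w → G w ≤ E)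
    (hG : ∀ w, 0 < w → G w ≤ q * G (2 * w) + c * w ^ (2 * s) * E) {w : ℝ} (hw : 0 < w) :
    G w ≤ (2 ^ s + c / (1 - q * 2 ^ s)) * w ^ s * E := by
  set M := 2 ^ s + c / (1 - q * 2 ^ s)
  have hMc : q * M * 2 ^ s + c ≤ M := doubling_constant_bound hq1 c
  have hMs : 2 ^ s ≤ M :=
    le_add_of_nonneg_right (div_nonneg hc (by linarith))
  have : 0 ≤ M := le_trans (by positivity) hMs
  have hlarge : ∀ w, 1 / 2 ≤ w → G w ≤ M * w ^ s * E := fun w hw => by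
    refine (hGE w (by linarith)).trans (le_mul_of_one_le_left hE ?_)
    calc (1 : ℝ) = 2 ^ s * (1 / 2) ^ s := by
          rw [← Real.mul_rpow (by norm_num) (by norm_num)]; norm_num
      _ ≤ M * w ^ s := by gcongr
  obtain ⟨k, hk⟩ : ∃ k : ℕ, 1 / 2 ≤ 2 ^ k * w := by
    obtain ⟨k, hk⟩ := pow_unbounded_of_one_lt (1 / w) (one_lt_two : (1 : ℝ) < 2)
    rw [div_lt_iff₀ hw] at hk
    exact ⟨k, by linarith⟩
  induction k generalizing w with
  | zero => exact hlarge w (by simpa using hk)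
  | succ k ih =>
    rcases le_or_gt (1 / 2) w with hw2 | hw2
    · exact hlarge w hw2
    have hdouble := ih (w := 2 * w) (by positivity) (by rw [pow_succ] at hk; linarith)
    rw [Real.mul_rpow (by norm_num) hw.le] at hdouble
    have hpow : w ^ (2 * s) ≤ w ^ s :=
      Real.rpow_le_rpow_of_exponent_ge hw (by linarith) (by linarith)
    calc G w ≤ q * (M * (2 ^ s * w ^ s) * E) + c * w ^ s * E := (hG w hw).trans (by gcongr)
      _ = (q * M * 2 ^ s + c) * w ^ s * E := by ring
      _ ≤ M * w ^ s * E := by gcongr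

theorem sq_le_mul_sq_add {l : ℝ} (hl : 1 < l) (a b : ℝ) :
    a ^ 2 ≤ l * b ^ 2 + l / (l - 1) * (a - b) ^ 2 := by
  have hl0 : 0 < l - 1 := by linarith
  have hdiff : l * b ^ 2 + l / (l - 1) * (a - b) ^ 2 - a ^ 2 =
      ((l - 1) * b - (a - b)) ^ 2 / (l - 1) := by
    field_simp; ring
  have hnonneg : 0 ≤ ((l - 1) * b - (a - b)) ^ 2 / (l - 1) := by positivity
  linarith

theorem Height.setLIntegral_comp_add_smul (h : Height n) (F : Rn n → ℝ≥0∞) (a b t : ℝ) :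
    ∫⁻ x in h ⁻¹' Ico a b, F (x + t • h.dir) = ∫⁻ x in h ⁻¹' Ico (a + t) (b + t), F x := by
  have hpre : h ⁻¹' Ico a b = (· + t • h.dir) ⁻¹' (h ⁻¹' Ico (a + t) (b + t)) := by
    ext x
    simp only [mem_preimage, mem_Ico, h.add_smul, add_le_add_iff_right, add_lt_add_iff_right]
  rw [hpre]
  exact (measurePreserving_add_right volume (t • h.dir)).setLIntegral_comp_preimage_emb
    (measurableEmbedding_addRight _) F _

theorem Height.lintegral_strip_add (h : Height n) (F : Rn n → ℝ≥0∞) {a b c : ℝ} (hab : a ≤ b)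
    (hbc : b ≤ c) :
    ∫⁻ x in h ⁻¹' Ico a c, F x =
      (∫⁻ x in h ⁻¹' Ico a b, F x) + ∫⁻ x in h ⁻¹' Ico b c, F x := by
  rw [← Ico_union_Ico_eq_Ico hab hbc, preimage_union]
  exact lintegral_union (h.measurable measurableSet_Ico)
    ((Ico_disjoint_Ico_same).preimage h)

/-- Shifting the strip by its width `w` trades its mass for that of the adjacent strip. -/
theorem Height.one_add_mul_lintegral_strip_le (h : Height n) {u : Rn n → ℝ} (hu : AEMeasurable u)
    {l w : ℝ} (hl : 1 < l) (hw : 0 ≤ w) :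
    ENNReal.ofReal (1 + l) * ∫⁻ x in h ⁻¹' Ico 0 w, ENNReal.ofReal (u x ^ 2) ≤
      ENNReal.ofReal l * (∫⁻ x in h ⁻¹' Ico 0 (2 * w), ENNReal.ofReal (u x ^ 2)) +
        ENNReal.ofReal (l / (l - 1)) *
          ∫⁻ x, ENNReal.ofReal ((u x - u (x + w • h.dir)) ^ 2) := by
  have hl0 : 0 ≤ l / (l - 1) := div_nonneg (by linarith) (by linarith)
  have hshifted : AEMeasurable (fun x => u (x + w • h.dir)) :=
    hu.comp_quasiMeasurePreserving (measurePreserving_add_right _ _).quasiMeasurePreserving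
  have hshift : ∫⁻ x in h ⁻¹' Ico 0 w, ENNReal.ofReal (u x ^ 2) ≤
      ENNReal.ofReal l * (∫⁻ x in h ⁻¹' Ico w (2 * w), ENNReal.ofReal (u x ^ 2)) +
        ENNReal.ofReal (l / (l - 1)) *
          ∫⁻ x, ENNReal.ofReal ((u x - u (x + w • h.dir)) ^ 2) := by
    calc ∫⁻ x in h ⁻¹' Ico 0 w, ENNReal.ofReal (u x ^ 2)
        ≤ ∫⁻ x in h ⁻¹' Ico 0 w, (ENNReal.ofReal l * ENNReal.ofReal (u (x + w • h.dir) ^ 2) +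
            ENNReal.ofReal (l / (l - 1)) *
              ENNReal.ofReal ((u x - u (x + w • h.dir)) ^ 2)) := by
          refine lintegral_mono fun x => ?_
          rw [← ENNReal.ofReal_mul (by positivity), ← ENNReal.ofReal_mul hl0,
            ← ENNReal.ofReal_add (by positivity) (by positivity)]
          exact ENNReal.ofReal_le_ofReal (sq_le_mul_sq_add hl _ _)
      _ ≤ _ := by
          rw [lintegral_add_left' (((hshifted.pow_const 2).ennreal_ofReal.const_mul _).restrict),
            lintegral_const_mul' _ _ ENNReal.ofReal_ne_top,
            lintegral_const_mul' _ _ ENNReal.ofReal_ne_top,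
            h.setLIntegral_comp_add_smul (fun x => ENNReal.ofReal (u x ^ 2)), zero_add, ← two_mul]
          gcongr
          exact Measure.restrict_le_self
  rw [h.lintegral_strip_add _ hw (by linarith : w ≤ 2 * w),
    ENNReal.ofReal_add zero_le_one (by linarith), ENNReal.ofReal_one, add_mul, one_mul, mul_add,
    add_assoc, add_comm]
  gcongr

theorem exists_one_lt_div_one_add_mul_lt_one (hs0 : 0 < s) (hs1 : s < 1) :
    ∃ l : ℝ, 1 < l ∧ l / (1 + l) * 2 ^ s < 1 := by
  have hlow : (1 : ℝ) < 2 ^ s := Real.one_lt_rpow one_lt_two hs0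
  have hupp : (2 : ℝ) ^ s < 2 := by
    simpa using Real.rpow_lt_rpow_of_exponent_lt one_lt_two hs1
  obtain ⟨l, hl1, hl⟩ := exists_between
    (one_lt_one_div (by linarith : (0 : ℝ) < 2 ^ s - 1) (by linarith))
  refine ⟨l, hl1, ?_⟩
  rw [lt_div_iff₀ (by linarith)] at hl
  rw [div_mul_eq_mul_div, div_lt_one (by linarith)]
  linarith

theorem exists_lintegral_strip_le (n : ℕ) (hs0 : 0 < s) (hs1 : s < 1) :
    ∃ M : ℝ, 0 < M ∧ ∀ u : Rn n → ℝ, AEMeasurable u → ∀ (h : Height n) (w : ℝ), 0 < w →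
      ∫⁻ x in h ⁻¹' Ico 0 w, ENNReal.ofReal (u x ^ 2) ≤
        ENNReal.ofReal (M * w ^ s) * hsEnergy s univ u := by
  obtain ⟨C, hC0, hC⟩ := exists_lintegral_sq_sub_translate_le n hs0
  obtain ⟨l, hl1, hls⟩ := exists_one_lt_div_one_add_mul_lt_one hs0 hs1
  have : 0 < l - 1 := by linarith
  have : 0 < 1 - l / (1 + l) * 2 ^ s := by linarith
  set c : ℝ := l / (l - 1) * C / (1 + l) with hc
  refine ⟨2 ^ s + c / (1 - l / (1 + l) * 2 ^ s), by positivity, fun u hu h w hw => ?_⟩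
  set E := hsEnergy s univ u
  by_cases hE : E = ⊤
  · rw [hE, ENNReal.mul_top (ENNReal.ofReal_pos.2 (by positivity)).ne']
    exact le_top
  set G : ℝ → ℝ≥0∞ := fun w => ∫⁻ x in h ⁻¹' Ico 0 w, ENNReal.ofReal (u x ^ 2)
  have hGE : ∀ w, G w ≤ E := fun w =>
    (lintegral_mono' (Measure.restrict_mono_set _ (subset_univ _)) le_rfl).trans
      (lintegral_sq_le_hsEnergy s univ u)
  have hG : ∀ w, G w ≠ ⊤ := fun w => ne_top_of_le_ne_top hE (hGE w)
  have hrec : ∀ w, 0 < w →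
      (G w).toReal ≤ l / (1 + l) * (G (2 * w)).toReal + c * w ^ (2 * s) * E.toReal := by
    intro w hw
    have hbound : ENNReal.ofReal (1 + l) * G w ≤ ENNReal.ofReal l * G (2 * w) +
        ENNReal.ofReal (l / (l - 1)) * (ENNReal.ofReal (C * w ^ (2 * s)) * E) := by
      refine (h.one_add_mul_lintegral_strip_le hu hl1 hw.le).trans ?_
      gcongr
      simpa [norm_smul, h.norm_dir, abs_of_pos hw] using hC u hu (w • h.dir)
    rw [← ENNReal.ofReal_toReal (hG w), ← ENNReal.ofReal_toReal (hG (2 * w)),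
      ← ENNReal.ofReal_toReal hE, ← ENNReal.ofReal_mul (by positivity),
      ← ENNReal.ofReal_mul (by positivity), ← ENNReal.ofReal_mul (by positivity),
      ← ENNReal.ofReal_mul (by positivity), ← ENNReal.ofReal_add (by positivity) (by positivity),
      ENNReal.ofReal_le_ofReal_iff (by positivity), ← le_div_iff₀' (by positivity)] at hbound
    exact hbound.trans_eq (by rw [hc]; ring)
  change G w ≤ _
  rw [← ENNReal.ofReal_toReal (hG w), ← ENNReal.ofReal_toReal hE,
    ← ENNReal.ofReal_mul (by positivity)]
  exact ENNReal.ofReal_le_ofReal <| le_of_doubling_recursion hs0 (by positivity) hls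
    (by positivity) ENNReal.toReal_nonneg (fun w _ => ENNReal.toReal_mono hE (hGE w)) hrec hw

theorem Height.thickening_subset_preimage_Ico (h : Height n) (δ : ℝ) :
    thickening δ {y | h y = 0} ⊆
      h.addConst ((h.lip + 1) * δ) ⁻¹' Ico 0 (2 * (h.lip + 1) * δ) := by
  intro y hy
  obtain ⟨z, hz : h z = 0, hyz⟩ := mem_thickening_iff.1 hy
  have hdist := h.lipschitz.dist_le_mul y z
  rw [hz, Real.dist_0_eq_abs] at hdist
  have habs : |h y| < (h.lip + 1) * δ := by
    have hmul : h.lip * dist y z ≤ h.lip * δ := by gcongr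
    linarith [(dist_nonneg (x := y) (y := z))]
  have habs' := abs_lt.1 habs
  constructor <;> simp only [addConst] <;> linarith

theorem exists_lintegral_thickening_frontier_le {Ω : Set (Rn n)} (hΩ : IsOpen Ω)
    (hΩ_bdd : Bornology.IsBounded Ω) (hΩ_lip : HasLipschitzBoundary Ω) (hs0 : 0 < s)
    (hs1 : s < 1) :
    ∃ M : ℝ, 0 ≤ M ∧ ∀ u : Rn n → ℝ, AEMeasurable u → ∀ δ : ℝ, 0 < δ →
      ∫⁻ x in thickening δ (frontier Ω), ENNReal.ofReal (u x ^ 2) ≤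
        ENNReal.ofReal (M * δ ^ s) * hsEnergy s univ u := by
  obtain ⟨M, hM0, hM⟩ := exists_lintegral_strip_le n hs0 hs1
  obtain ⟨ι, _, h, hcov⟩ := exists_finite_heights hΩ hΩ_bdd hΩ_lip
  refine ⟨∑ i, M * (2 * ((h i).lip + 1 : ℝ)) ^ s, by positivity, fun u hu δ hδ => ?_⟩
  have hsub : thickening δ (frontier Ω) ⊆
      ⋃ i, (h i).addConst (((h i).lip + 1) * δ) ⁻¹' Ico 0 (2 * ((h i).lip + 1) * δ) := by
    refine (thickening_subset_of_subset δ hcov).trans ?_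
    rw [thickening_iUnion]
    exact iUnion_mono fun i => (h i).thickening_subset_preimage_Ico δ
  calc ∫⁻ x in thickening δ (frontier Ω), ENNReal.ofReal (u x ^ 2)
      ≤ ∑ i, ∫⁻ x in (h i).addConst (((h i).lip + 1) * δ) ⁻¹' Ico 0 (2 * ((h i).lip + 1) * δ),
          ENNReal.ofReal (u x ^ 2) := by
        refine (lintegral_mono_set hsub).trans ((lintegral_iUnion_le _ _).trans_eq ?_)
        rw [tsum_fintype]
    _ ≤ ∑ i, ENNReal.ofReal (M * (2 * ((h i).lip + 1) * δ) ^ s) * hsEnergy s univ u :=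
        Finset.sum_le_sum fun i _ => hM u hu _ _ (by positivity)
    _ = _ := by
        rw [← Finset.sum_mul, ← ENNReal.ofReal_sum_of_nonneg fun i _ => by positivity,
          Finset.sum_mul]
        congr 2
        refine Finset.sum_congr rfl fun i _ => ?_
        rw [Real.mul_rpow (by positivity) hδ.le, mul_assoc]

theorem exists_eLpNorm_boundaryLayer_le {Ω : Set (Rn n)} (hΩ : IsOpen Ω)
    (hΩ_bdd : Bornology.IsBounded Ω) (hΩ_lip : HasLipschitzBoundary Ω) (hs0 : 0 < s)
    (hs1 : s < 1) (k : ℕ) :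
    ∃ C : ℝ≥0, ∀ ε : ℝ, 0 < ε → ∀ u : Rn n → ℝ, AEMeasurable u →
      eLpNorm u 2 (volume.restrict (boundaryLayer Ω ε k)) ≤
        ENNReal.ofReal (C * ε ^ (s / 2)) * hsNorm s univ u := by
  obtain ⟨M, hM0, hM⟩ := exists_lintegral_thickening_frontier_le hΩ hΩ_bdd hΩ_lip hs0 hs1
  refine ⟨⟨√(M * (k * √n + 1) ^ s), Real.sqrt_nonneg _⟩, fun ε hε u hu => ?_⟩
  refine eLpNorm_le_hsNorm_of_lintegral_sq_le (by positivity) hε.le ?_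
  simp only [Real.norm_eq_abs, sq_abs]
  calc ∫⁻ x in boundaryLayer Ω ε k, ENNReal.ofReal (u x ^ 2)
      ≤ ∫⁻ x in thickening ((k * √n + 1) * ε) (frontier Ω), ENNReal.ofReal (u x ^ 2) :=
        lintegral_mono_set (thickening_mono (by linarith) _)
    _ ≤ ENNReal.ofReal (M * ((k * √n + 1) * ε) ^ s) * hsEnergy s univ u :=
        hM u hu _ (by positivity)
    _ = _ := by
        rw [Real.mul_rpow (by positivity) hε.le, mul_div_cancel₀ s two_ne_zero, mul_assoc]

end Strips

section SurfaceMeasure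

variable {n : ℕ}

namespace Height

theorem finrank_orthogonal_dir (h : Height n) :
    Module.finrank ℝ (ℝ ∙ h.dir)ᗮ = n - 1 := by
  have hdir : h.dir ≠ 0 := norm_pos_iff.1 (h.norm_dir ▸ one_pos)
  have hsum := (ℝ ∙ h.dir).finrank_add_finrank_orthogonal
  rw [finrank_span_singleton hdir, finrank_euclideanSpace_fin] at hsum
  omega

/-- The parametrization of the zero set of `h` by the hyperplane orthogonal to `h.dir`. -/
def graphMap (h : Height n) (w : (ℝ ∙ h.dir)ᗮ) : Rn n := w - h w • h.dir

theorem lipschitzWith_graphMap (h : Height n) : LipschitzWith (1 + h.lip) h.graphMap := by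
  have hcoe : LipschitzWith 1 ((↑) : (ℝ ∙ h.dir)ᗮ → Rn n) := LipschitzWith.subtype_val _
  refine hcoe.sub (LipschitzWith.of_dist_le_mul fun w w' => ?_)
  rw [dist_eq_norm, ← sub_smul, norm_smul, h.norm_dir, mul_one, ← dist_eq_norm]
  exact h.lipschitz.dist_le_mul w w'

theorem graphMap_orthogonalProjectionOnto (h : Height n) {x : Rn n} (hx : h x = 0) :
    h.graphMap ((ℝ ∙ h.dir)ᗮ.orthogonalProjectionOnto x) = x := by
  obtain ⟨t, ht⟩ := Submodule.mem_span_singleton.1 <|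
    (Submodule.orthogonal_orthogonal (ℝ ∙ h.dir)).le
      ((ℝ ∙ h.dir)ᗮ.sub_starProjection_mem_orthogonal x)
  have hproj : ((ℝ ∙ h.dir)ᗮ.orthogonalProjectionOnto x : Rn n) = x + (-t) • h.dir := by
    rw [neg_smul, ht, neg_sub, add_sub_cancel, Submodule.starProjection_apply]
  rw [graphMap, hproj, h.add_smul, hx]
  module

theorem exists_hausdorffMeasure_le (h : Height n) :
    ∃ C : ℝ, 0 ≤ C ∧ ∀ (y : Rn n) (r : ℝ), 0 ≤ r →
      μH[(n - 1 : ℕ)] ({x | h x = 0} ∩ closedBall y r) ≤ ENNReal.ofReal (C * r ^ (n - 1)) := by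
  have haar : (μH[(n - 1 : ℕ)] : Measure (ℝ ∙ h.dir)ᗮ).IsAddHaarMeasure := by
    rw [← h.finrank_orthogonal_dir]
    infer_instance
  set p := (ℝ ∙ h.dir)ᗮ.orthogonalProjectionOnto
  set β : ℝ := μH[(n - 1 : ℕ)].real (ball (0 : (ℝ ∙ h.dir)ᗮ) 1) with hβ
  refine ⟨(1 + h.lip) ^ (n - 1) * β, by positivity, fun y r hr => ?_⟩
  have hsub : {x | h x = 0} ∩ closedBall y r ⊆ h.graphMap '' closedBall (p y) r := by
    rintro x ⟨hx, hxy⟩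
    refine ⟨p x, ?_, h.graphMap_orthogonalProjectionOnto hx⟩
    rw [mem_closedBall, ← one_mul r]
    exact (Submodule.lipschitzWith_orthogonalProjectionOnto _).dist_le_mul_of_le hxy
  calc μH[(n - 1 : ℕ)] ({x | h x = 0} ∩ closedBall y r)
      ≤ ((1 + h.lip : ℝ≥0) : ℝ≥0∞) ^ ((n - 1 : ℕ) : ℝ) * μH[(n - 1 : ℕ)] (closedBall (p y) r) :=
        (measure_mono hsub).trans
          (h.lipschitzWith_graphMap.hausdorffMeasure_image_le (Nat.cast_nonneg _) _)
    _ = ENNReal.ofReal ((1 + h.lip) ^ (n - 1) * β * r ^ (n - 1)) := by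
        rw [Measure.addHaar_closedBall _ _ hr, h.finrank_orthogonal_dir, ENNReal.rpow_natCast,
          ← ENNReal.ofReal_coe_nnreal, ← ofReal_measureReal measure_ball_lt_top.ne, ← hβ,
          ← ENNReal.ofReal_pow (by positivity), ← ENNReal.ofReal_mul (by positivity),
          ← ENNReal.ofReal_mul (by positivity)]
        push_cast
        congr 1
        ring

end Height

variable {Ω : Set (Rn n)}

theorem exists_surfaceMeasure_closedBall_le (hn : 0 < n) (hΩ : IsOpen Ω)
    (hΩ_bdd : Bornology.IsBounded Ω) (hΩ_lip : HasLipschitzBoundary Ω) :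
    ∃ C : ℝ, 0 ≤ C ∧ ∀ (y : Rn n) (r : ℝ), 0 ≤ r →
      surfaceMeasure Ω (closedBall y r) ≤ ENNReal.ofReal (C * r ^ (n - 1)) := by
  obtain ⟨ι, _, h, hcov⟩ := exists_finite_heights hΩ hΩ_bdd hΩ_lip
  choose C hC0 hC using fun i => (h i).exists_hausdorffMeasure_le
  refine ⟨∑ i, C i, Finset.sum_nonneg fun i _ => hC0 i, fun y r hr => ?_⟩
  rw [surfaceMeasure, Measure.restrict_apply measurableSet_closedBall, Finset.sum_mul, inter_comm,
    ENNReal.ofReal_sum_of_nonneg fun i _ => mul_nonneg (hC0 i) (by positivity),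
    ← Nat.cast_pred hn]
  calc μH[(n - 1 : ℕ)] (frontier Ω ∩ closedBall y r)
      ≤ μH[(n - 1 : ℕ)] (⋃ i, {x | h i x = 0} ∩ closedBall y r) := by
        rw [← iUnion_inter]
        gcongr
    _ ≤ ∑ i, μH[(n - 1 : ℕ)] ({x | h i x = 0} ∩ closedBall y r) :=
        measure_iUnion_fintype_le _ _
    _ ≤ ∑ i, ENNReal.ofReal (C i * r ^ (n - 1)) := Finset.sum_le_sum fun i _ => hC i y r hr

theorem isFiniteMeasure_surfaceMeasure (hn : 0 < n) (hΩ : IsOpen Ω)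
    (hΩ_bdd : Bornology.IsBounded Ω) (hΩ_lip : HasLipschitzBoundary Ω) :
    IsFiniteMeasure (surfaceMeasure Ω) := by
  obtain ⟨C, -, hC⟩ := exists_surfaceMeasure_closedBall_le hn hΩ hΩ_bdd hΩ_lip
  obtain ⟨R, hR, hsub⟩ :=
    (isCompact_frontier_of_isBounded hΩ_bdd).isBounded.subset_closedBall_lt 0 (0 : Rn n)
  refine ⟨(le_of_eq ?_).trans_lt ((hC 0 R hR.le).trans_lt ENNReal.ofReal_lt_top)⟩
  rw [surfaceMeasure, Measure.restrict_apply_univ,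
    Measure.restrict_apply measurableSet_closedBall, inter_eq_right.2 hsub]

/-- At a boundary point the interpolate only sees values taken in the layer around `∂Ω`, and each
value is seen from a portion of `∂Ω` of surface measure at most of order `ε ^ (n - 1)`. -/
theorem lintegral_sq_q1Interp_surfaceMeasure_le (hn : 0 < n) [IsFiniteMeasure (surfaceMeasure Ω)]
    {C : ℝ} (hC : ∀ (y : Rn n) (r : ℝ), 0 ≤ r →
      surfaceMeasure Ω (closedBall y r) ≤ ENNReal.ofReal (C * r ^ (n - 1)))
    {ε : ℝ} (hε : 0 < ε) {u : Rn n → ℝ} (hu : AEMeasurable u) :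
    ∫⁻ x, ENNReal.ofReal (q1Interp ε u x ^ 2) ∂(surfaceMeasure Ω) ≤
      ENNReal.ofReal (2 ^ n * C * (2 * √n) ^ (n - 1) * ε⁻¹) *
        ∫⁻ y in thickening (3 * √n * ε) (frontier Ω), ENNReal.ofReal (u y ^ 2) := by
  set r := 2 * √n * ε with hr
  set ν : Measure (Rn n) := volume.restrict (thickening (3 * √n * ε) (frontier Ω)) with hν
  set c := ENNReal.ofReal (2 ^ n * (ε ^ n)⁻¹) with hc
  have hsq : AEMeasurable (fun y => ENNReal.ofReal (u y ^ 2)) ν :=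
    (hu.restrict.pow_const 2).ennreal_ofReal
  have hrad : r < 3 * √n * ε := by
    have : 0 < √n * ε := by positivity
    rw [hr]
    linarith
  have hpoint : ∀ x ∈ frontier Ω, ENNReal.ofReal (q1Interp ε u x ^ 2) ≤
      c * ∫⁻ y in closedBall x r, ENNReal.ofReal (u y ^ 2) ∂ν := fun x hx => by
    rw [hν, Measure.restrict_restrict_of_subset <| (closedBall_subset_ball hrad).trans
      (ball_subset_thickening hx _)]
    simpa only [zero_sub, neg_sq] using ofReal_sq_sub_q1Interp_le hε hu x 0
  calc ∫⁻ x, ENNReal.ofReal (q1Interp ε u x ^ 2) ∂(surfaceMeasure Ω)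
      ≤ ∫⁻ x, c * (∫⁻ y in closedBall x r, ENNReal.ofReal (u y ^ 2) ∂ν) ∂(surfaceMeasure Ω) :=
        setLIntegral_mono' isClosed_frontier.measurableSet hpoint
    _ = c * ∫⁻ y, ENNReal.ofReal (u y ^ 2) * surfaceMeasure Ω (closedBall y r) ∂ν := by
        rw [lintegral_const_mul' _ _ ENNReal.ofReal_ne_top, lintegral_lintegral_closedBall hsq]
    _ ≤ c * ((∫⁻ y, ENNReal.ofReal (u y ^ 2) ∂ν) * ENNReal.ofReal (C * r ^ (n - 1))) := by
        rw [← lintegral_mul_const' _ _ ENNReal.ofReal_ne_top]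
        gcongr with y
        exact hC y r (by positivity)
    _ = _ := by
        rw [mul_left_comm, mul_comm, hc, ← ENNReal.ofReal_mul (by positivity)]
        congr 2
        obtain ⟨m, rfl⟩ := Nat.exists_eq_add_of_le' hn
        rw [hr, mul_pow _ ε, Nat.add_sub_cancel]
        field_simp
        ring

theorem exists_eLpNorm_q1Interp_surfaceMeasure_le (hn : 0 < n) (hΩ : IsOpen Ω)
    (hΩ_bdd : Bornology.IsBounded Ω) (hΩ_lip : HasLipschitzBoundary Ω) {s : ℝ} (hs0 : 0 < s)
    (hs1 : s < 1) :
    ∃ C : ℝ≥0, ∀ ε : ℝ, 0 < ε → ∀ u : Rn n → ℝ, AEMeasurable u →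
      eLpNorm (q1Interp ε u) 2 (surfaceMeasure Ω) ≤
        ENNReal.ofReal (C * ε ^ ((s - 1) / 2)) * hsNorm s univ u := by
  obtain ⟨A, hA0, hA⟩ := exists_surfaceMeasure_closedBall_le hn hΩ hΩ_bdd hΩ_lip
  obtain ⟨M, hM0, hM⟩ := exists_lintegral_thickening_frontier_le hΩ hΩ_bdd hΩ_lip hs0 hs1
  have := isFiniteMeasure_surfaceMeasure hn hΩ hΩ_bdd hΩ_lip
  refine ⟨⟨√(2 ^ n * A * (2 * √n) ^ (n - 1) * (M * (3 * √n) ^ s)), Real.sqrt_nonneg _⟩,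
    fun ε hε u hu => ?_⟩
  refine eLpNorm_le_hsNorm_of_lintegral_sq_le (by positivity) hε.le ?_
  simp only [Real.norm_eq_abs, sq_abs]
  refine (lintegral_sq_q1Interp_surfaceMeasure_le hn hA hε hu).trans ?_
  refine (mul_le_mul_right (hM u hu _ (by positivity)) _).trans_eq ?_
  rw [← mul_assoc, ← ENNReal.ofReal_mul (by positivity), Real.mul_rpow (by positivity) hε.le,
    mul_div_cancel₀ (s - 1) two_ne_zero, Real.rpow_sub_one hε.ne']
  congr 2
  field_simp

end SurfaceMeasure

section CutoffKernel

theorem integrableOn_Ioi_min_mul_rpow {s : ℝ} (hs0 : 0 < s) (hs1 : s < 1) (Λ : ℝ) :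
    IntegrableOn (fun r : ℝ => min ((Λ * r) ^ 2) 4 * r ^ (-1 - 2 * s)) (Ioi 0) := by
  have hmeas : Measurable fun r : ℝ => min ((Λ * r) ^ 2) 4 * r ^ (-1 - 2 * s) := by fun_prop
  have hnorm : ∀ r : ℝ, 0 < r → ‖min ((Λ * r) ^ 2) 4 * r ^ (-1 - 2 * s)‖ =
      min ((Λ * r) ^ 2) 4 * r ^ (-1 - 2 * s) := fun r hr =>
    Real.norm_of_nonneg (by positivity)
  rw [← Ioc_union_Ioi_eq_Ioi zero_le_one]
  refine IntegrableOn.union ?_ ?_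
  · have hnear : IntegrableOn (fun r : ℝ => Λ ^ 2 * r ^ (1 - 2 * s)) (Ioc 0 1) :=
      ((intervalIntegrable_iff_integrableOn_Ioc_of_le zero_le_one).1
        (intervalIntegral.intervalIntegrable_rpow' (by linarith))).const_mul _
    refine hnear.mono' hmeas.aestronglyMeasurable ?_
    refine (ae_restrict_mem measurableSet_Ioc).mono fun r hr => ?_
    have := hr.1
    calc ‖min ((Λ * r) ^ 2) 4 * r ^ (-1 - 2 * s)‖ ≤ (Λ * r) ^ 2 * r ^ (-1 - 2 * s) := by
          rw [hnorm r hr.1]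
          gcongr
          exact min_le_left _ _
      _ = Λ ^ 2 * (r ^ (2 : ℝ) * r ^ (-1 - 2 * s)) := by rw [Real.rpow_two]; ring
      _ = Λ ^ 2 * r ^ (1 - 2 * s) := by rw [← Real.rpow_add hr.1]; ring_nf
  · have hfar : IntegrableOn (fun r : ℝ => 4 * r ^ (-1 - 2 * s)) (Ioi 1) :=
      (integrableOn_Ioi_rpow_of_lt (by linarith) one_pos).const_mul _
    refine hfar.mono' hmeas.aestronglyMeasurable ?_
    refine (ae_restrict_mem measurableSet_Ioi).mono fun r hr => ?_
    have hr0 : 0 < r := one_pos.trans hr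
    rw [hnorm r hr0]
    gcongr
    exact min_le_right _ _

theorem integrable_min_div_norm_rpow {E : Type*} [NormedAddCommGroup E] [NormedSpace ℝ E]
    [FiniteDimensional ℝ E] [MeasurableSpace E] [BorelSpace E] (μ : Measure E)
    [μ.IsAddHaarMeasure] {s : ℝ} (hs0 : 0 < s) (hs1 : s < 1) (Λ : ℝ) :
    Integrable (fun z : E =>
      min ((Λ * ‖z‖) ^ 2) 4 / ‖z‖ ^ ((Module.finrank ℝ E : ℝ) + 2 * s)) μ := by
  rcases subsingleton_or_nontrivial E with _ | _
  · have hzero : ∀ z : E, ‖z‖ = 0 := fun z => by rw [Subsingleton.elim z 0, norm_zero]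
    simp [hzero]
  rw [integrable_fun_norm_addHaar μ
    (f := fun r : ℝ => min ((Λ * r) ^ 2) 4 / r ^ ((Module.finrank ℝ E : ℝ) + 2 * s))]
  refine (integrableOn_Ioi_min_mul_rpow hs0 hs1 Λ).congr_fun (fun r hr => ?_) measurableSet_Ioi
  have hpow : r ^ (Module.finrank ℝ E - 1) = r ^ ((Module.finrank ℝ E : ℝ) - 1) := by
    rw [← Real.rpow_natCast, Nat.cast_sub Module.finrank_pos, Nat.cast_one]
  simp only [smul_eq_mul]
  rw [hpow, mul_div_left_comm, ← Real.rpow_sub hr]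
  ring_nf

theorem exists_lintegral_cutoff_kernel_le {n : ℕ} {s : ℝ} (hs0 : 0 < s) (hs1 : s < 1)
    {θ : Rn n → ℝ} {Λ : ℝ≥0} (hθ : LipschitzWith Λ θ) (hθ1 : ∀ x, |θ x| ≤ 1) :
    ∃ C : ℝ≥0, ∀ x, ∫⁻ y, ENNReal.ofReal ((θ x - θ y) ^ 2 / ‖x - y‖ ^ ((n : ℝ) + 2 * s)) ≤ C := by
  have hint := integrable_min_div_norm_rpow (volume : Measure (Rn n)) hs0 hs1 Λ
  rw [finrank_euclideanSpace_fin] at hint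
  refine ⟨(∫⁻ z : Rn n, ENNReal.ofReal
    (min ((Λ * ‖z‖) ^ 2) 4 / ‖z‖ ^ ((n : ℝ) + 2 * s))).toNNReal, fun x => ?_⟩
  rw [ENNReal.coe_toNNReal hint.lintegral_lt_top.ne, ← lintegral_sub_left_eq_self
    (fun z : Rn n => ENNReal.ofReal (min ((Λ * ‖z‖) ^ 2) 4 / ‖z‖ ^ ((n : ℝ) + 2 * s))) x]
  refine lintegral_mono fun y => ENNReal.ofReal_le_ofReal ?_
  have hlip : |θ x - θ y| ≤ Λ * ‖x - y‖ := by
    simpa only [dist_eq_norm, Real.norm_eq_abs] using hθ.dist_le_mul x y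
  have hbdd : |θ x - θ y| ≤ 2 := (abs_sub _ _).trans (by linarith [hθ1 x, hθ1 y])
  rw [← sq_abs (θ x - θ y)]
  gcongr
  refine le_min (by gcongr) ?_
  calc |θ x - θ y| ^ 2 ≤ 2 ^ 2 := by gcongr
    _ = 4 := by norm_num

end CutoffKernel

section CutoffEnergy

theorem lintegral_lintegral_eq_add_compl {α : Type*} [MeasurableSpace α] {μ : Measure α}
    [SFinite μ] {q : α → α → ℝ≥0∞} (hq : Measurable (Function.uncurry q))
    (hsymm : ∀ x y, q x y = q y x) {V : Set α} (hV : MeasurableSet V)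
    (hzero : ∀ x ∈ Vᶜ, ∀ y ∈ Vᶜ, q x y = 0) :
    ∫⁻ x, ∫⁻ y, q x y ∂μ ∂μ =
      ∫⁻ x in V, ((∫⁻ y in V, q x y ∂μ) + 2 * ∫⁻ y in Vᶜ, q x y ∂μ) ∂μ := by
  have hmeas : ∀ S, Measurable fun x => ∫⁻ y in S, q x y ∂μ := fun S => hq.lintegral_prod_right'
  have hcompl : ∫⁻ x in Vᶜ, ∫⁻ y in Vᶜ, q x y ∂μ ∂μ = 0 := by
    rw [setLIntegral_congr_fun hV.compl (g := 0), lintegral_zero_fun]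
    intro x hx
    exact (setLIntegral_congr_fun hV.compl (hzero x hx)).trans lintegral_zero
  have hcross : ∫⁻ x in Vᶜ, ∫⁻ y, q x y ∂μ ∂μ = ∫⁻ x in V, ∫⁻ y in Vᶜ, q x y ∂μ ∂μ := by
    rw [lintegral_lintegral_swap (f := q) hq.aemeasurable]
    refine (lintegral_congr fun y => lintegral_congr fun x => hsymm x y).trans ?_
    rw [← lintegral_add_compl _ hV, hcompl, add_zero]
  rw [← lintegral_add_compl _ hV, hcross, ← lintegral_add_right _ (hmeas Vᶜ)]
  refine lintegral_congr fun x => ?_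
  rw [← lintegral_add_compl (q x) hV, add_assoc, two_mul]

variable {n : ℕ} {s : ℝ} {θ f : Rn n → ℝ} {V : Set (Rn n)}

theorem measurable_gagliardo_integrand (s : ℝ) (hf : Measurable f) :
    Measurable fun p : Rn n × Rn n =>
      ENNReal.ofReal ((f p.1 - f p.2) ^ 2 / ‖p.1 - p.2‖ ^ ((n : ℝ) + 2 * s)) := by
  fun_prop

theorem gagliardo_univ_eq_of_eqOn_compl (hf : Measurable f) (hV : MeasurableSet V)
    (hfV : ∀ x ∈ Vᶜ, f x = 0) :
    gagliardo s univ f = ∫⁻ x in V,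
      ((∫⁻ y in V, ENNReal.ofReal ((f x - f y) ^ 2 / ‖x - y‖ ^ ((n : ℝ) + 2 * s))) +
        2 * ∫⁻ y in Vᶜ, ENNReal.ofReal ((f x - f y) ^ 2 / ‖x - y‖ ^ ((n : ℝ) + 2 * s))) := by
  unfold gagliardo
  rw [Measure.restrict_univ]
  refine lintegral_lintegral_eq_add_compl (measurable_gagliardo_integrand s hf) (fun x y => ?_) hV
    fun x hx y hy => ?_
  · rw [← neg_sub (f y), neg_sq, norm_sub_rev]
  · simp only [hfV x hx, hfV y hy, sub_self, ne_eq, OfNat.ofNat_ne_zero, not_false_eq_true,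
      zero_pow, zero_div, ENNReal.ofReal_zero]

theorem ofReal_sq_mul_sub_mul_div_le {a b c d D : ℝ} (hb : |b| ≤ 1) (hD : 0 ≤ D) :
    ENNReal.ofReal ((a * c - b * d) ^ 2 / D) ≤
      2 * (ENNReal.ofReal (c ^ 2) * ENNReal.ofReal ((a - b) ^ 2 / D)) +
        2 * ENNReal.ofReal ((c - d) ^ 2 / D) := by
  have htwo : (2 : ℝ≥0∞) = ENNReal.ofReal 2 := by simp only [ENNReal.ofReal_ofNat]
  rw [htwo, ← ENNReal.ofReal_mul (by positivity), ← ENNReal.ofReal_mul (by positivity),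
    ← ENNReal.ofReal_mul (by positivity), ← ENNReal.ofReal_add (by positivity) (by positivity)]
  refine ENNReal.ofReal_le_ofReal ?_
  have hb2 : (b * (c - d)) ^ 2 ≤ (c - d) ^ 2 := by
    rw [mul_pow]
    exact mul_le_of_le_one_left (sq_nonneg _) ((sq_le_one_iff_abs_le_one b).2 hb)
  calc (a * c - b * d) ^ 2 / D = (c * (a - b) + b * (c - d)) ^ 2 / D := by ring
    _ ≤ (2 * (c ^ 2 * (a - b) ^ 2) + 2 * (c - d) ^ 2) / D := by
        gcongr
        nlinarith [sq_nonneg (c * (a - b) - b * (c - d))]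
    _ = 2 * (c ^ 2 * ((a - b) ^ 2 / D)) + 2 * ((c - d) ^ 2 / D) := by ring

theorem lintegral_cutoff_le {C : ℝ≥0} (hθ1 : ∀ x, |θ x| ≤ 1) (hθ : Measurable θ)
    (hV : MeasurableSet V) (hθV : ∀ x ∈ Vᶜ, θ x = 0) (hf : Measurable f) (x : Rn n)
    (hC : ∫⁻ y, ENNReal.ofReal ((θ x - θ y) ^ 2 / ‖x - y‖ ^ ((n : ℝ) + 2 * s)) ≤ C) :
    (∫⁻ y in V, ENNReal.ofReal
        ((θ x * f x - θ y * f y) ^ 2 / ‖x - y‖ ^ ((n : ℝ) + 2 * s))) +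
      2 * ∫⁻ y in Vᶜ, ENNReal.ofReal
        ((θ x * f x - θ y * f y) ^ 2 / ‖x - y‖ ^ ((n : ℝ) + 2 * s)) ≤
    2 * C * ENNReal.ofReal (f x ^ 2) +
      2 * ∫⁻ y in V, ENNReal.ofReal ((f x - f y) ^ 2 / ‖x - y‖ ^ ((n : ℝ) + 2 * s)) := by
  set D : Rn n → ℝ := fun y => ‖x - y‖ ^ ((n : ℝ) + 2 * s)
  have hD0 : ∀ y, 0 ≤ D y := fun y => Real.rpow_nonneg (norm_nonneg _) _
  have hkm : Measurable fun y => ENNReal.ofReal ((θ x - θ y) ^ 2 / D y) := by fun_prop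
  have hinside : ∫⁻ y in V, ENNReal.ofReal ((θ x * f x - θ y * f y) ^ 2 / D y) ≤
      2 * (ENNReal.ofReal (f x ^ 2) * ∫⁻ y in V, ENNReal.ofReal ((θ x - θ y) ^ 2 / D y)) +
        2 * ∫⁻ y in V, ENNReal.ofReal ((f x - f y) ^ 2 / D y) := by
    rw [← lintegral_const_mul _ hkm, ← lintegral_const_mul _ (hkm.const_mul _),
      ← lintegral_const_mul _ (by fun_prop), ← lintegral_add_left ((hkm.const_mul _).const_mul _)]
    exact lintegral_mono fun y => ofReal_sq_mul_sub_mul_div_le (hθ1 y) (hD0 y)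
  have houtside : ∫⁻ y in Vᶜ, ENNReal.ofReal ((θ x * f x - θ y * f y) ^ 2 / D y) =
      ENNReal.ofReal (f x ^ 2) * ∫⁻ y in Vᶜ, ENNReal.ofReal ((θ x - θ y) ^ 2 / D y) := by
    rw [← lintegral_const_mul _ hkm]
    refine setLIntegral_congr_fun hV.compl fun y hy => ?_
    simp only [hθV y hy]
    rw [← ENNReal.ofReal_mul (sq_nonneg _)]
    ring_nf
  rw [houtside]
  refine (add_le_add_left hinside _).trans ?_
  rw [add_right_comm, ← mul_add, ← mul_add (ENNReal.ofReal (f x ^ 2)),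
    lintegral_add_compl _ hV, mul_assoc, mul_comm (C : ℝ≥0∞)]
  gcongr

theorem exists_hsEnergy_cutoff_le (hs0 : 0 < s) (hs1 : s < 1) {Λ : ℝ≥0} (hθ : LipschitzWith Λ θ)
    (hθ1 : ∀ x, |θ x| ≤ 1) (hV : MeasurableSet V) (hθV : ∀ x ∈ Vᶜ, θ x = 0) :
    ∃ C : ℝ≥0, ∀ f : Rn n → ℝ, Measurable f →
      hsEnergy s univ (fun x => θ x * f x) ≤ C * hsEnergy s V f := by
  obtain ⟨C, hC⟩ := exists_lintegral_cutoff_kernel_le hs0 hs1 hθ hθ1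
  refine ⟨2 * C + 2, fun f hf => ?_⟩
  have hθm : Measurable θ := hθ.continuous.measurable
  have hzero : ∀ x ∈ Vᶜ, θ x * f x = 0 := fun x hx => by rw [hθV x hx, zero_mul]
  have hL2 : ∫⁻ x in univ, ENNReal.ofReal ((θ x * f x) ^ 2) ≤
      ∫⁻ x in V, ENNReal.ofReal (f x ^ 2) := by
    rw [Measure.restrict_univ, ← lintegral_add_compl _ hV,
      setLIntegral_congr_fun (g := 0) hV.compl fun x hx => by simp [hzero x hx],
      lintegral_zero_fun, add_zero]
    refine lintegral_mono fun x => ENNReal.ofReal_le_ofReal ?_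
    rw [mul_pow]
    exact mul_le_of_le_one_left (sq_nonneg _) ((sq_le_one_iff_abs_le_one _).2 (hθ1 x))
  have hgag : gagliardo s univ (fun x => θ x * f x) ≤
      2 * C * (∫⁻ x in V, ENNReal.ofReal (f x ^ 2)) + 2 * gagliardo s V f := by
    rw [gagliardo_univ_eq_of_eqOn_compl (f := fun x => θ x * f x) (hθm.mul hf) hV hzero]
    refine (lintegral_mono fun x => lintegral_cutoff_le hθ1 hθm hV hθV hf x (hC x)).trans_eq ?_
    rw [lintegral_add_left (by fun_prop), lintegral_const_mul _ (by fun_prop),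
      lintegral_const_mul' _ _ ENNReal.ofNat_ne_top, gagliardo]
  calc hsEnergy s univ (fun x => θ x * f x)
      ≤ (∫⁻ x in V, ENNReal.ofReal (f x ^ 2)) +
          (2 * C * (∫⁻ x in V, ENNReal.ofReal (f x ^ 2)) + 2 * gagliardo s V f) :=
        add_le_add hL2 hgag
    _ = (2 * C + 1) * (∫⁻ x in V, ENNReal.ofReal (f x ^ 2)) + 2 * gagliardo s V f := by ring
    _ ≤ (2 * C + 2) * (∫⁻ x in V, ENNReal.ofReal (f x ^ 2)) +
          (2 * C + 2) * gagliardo s V f := by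
        gcongr
        · exact one_le_two
        · exact le_add_self
    _ = ↑(2 * C + 2) * hsEnergy s V f := by
        rw [← mul_add, hsEnergy]
        norm_cast

end CutoffEnergy

section Composition

theorem lintegral_comp_le_of_map_le {α β : Type*} [MeasurableSpace α] [MeasurableSpace β]
    {μ : Measure α} {ν : Measure β} {T : α → β} (hT : Measurable T) {M : ℝ≥0}
    (hM : μ.map T ≤ M • ν) {F : β → ℝ≥0∞} (hF : Measurable F) :
    ∫⁻ x, F (T x) ∂μ ≤ M * ∫⁻ y, F y ∂ν := by
  rw [← lintegral_map hF hT]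
  exact (lintegral_mono' hM le_rfl).trans_eq (lintegral_smul_measure M F)

variable {n : ℕ} {s : ℝ} {Ω V : Set (Rn n)} {T : Rn n → Rn n} {K M : ℝ≥0}

theorem ofReal_sq_sub_comp_div_le {E : Type*} [NormedAddCommGroup E] {T : E → E} {K : ℝ≥0}
    (hT : LipschitzWith K T) {p : ℝ} (hp : 0 ≤ p) (f : E → ℝ) (x y : E) :
    ENNReal.ofReal ((f (T x) - f (T y)) ^ 2 / ‖x - y‖ ^ p) ≤
      (K ^ p : ℝ≥0) * ENNReal.ofReal ((f (T x) - f (T y)) ^ 2 / ‖T x - T y‖ ^ p) := by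
  rw [← ENNReal.ofReal_coe_nnreal, ← ENNReal.ofReal_mul NNReal.zero_le_coe]
  refine ENNReal.ofReal_le_ofReal ?_
  rcases eq_or_ne (T x) (T y) with hxy | hxy
  · simp [hxy]
  have hTxy : 0 < ‖T x - T y‖ := norm_pos_iff.2 (sub_ne_zero.2 hxy)
  have hxy' : 0 < ‖x - y‖ := norm_pos_iff.2 (sub_ne_zero.2 fun h => hxy (congrArg T h))
  have hle : ‖T x - T y‖ ^ p ≤ K ^ p * ‖x - y‖ ^ p := by
    rw [← Real.mul_rpow K.coe_nonneg hxy'.le]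
    exact Real.rpow_le_rpow hTxy.le (by simpa only [dist_eq_norm] using hT.dist_le_mul x y) hp
  rw [NNReal.coe_rpow, mul_div_assoc', div_le_div_iff₀ (by positivity) (by positivity),
    mul_comm ((K : ℝ) ^ p), mul_assoc]
  gcongr

theorem gagliardo_comp_le (hs : 0 ≤ s) (hT : LipschitzWith K T)
    (hM : (volume.restrict V).map T ≤ M • volume.restrict Ω) {f : Rn n → ℝ} (hf : Measurable f) :
    gagliardo s V (f ∘ T) ≤
      (K ^ ((n : ℝ) + 2 * s) : ℝ≥0) * (M * (M * gagliardo s Ω f)) := by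
  have hTm : Measurable T := hT.continuous.measurable
  set g : Rn n → Rn n → ℝ≥0∞ := fun x y =>
    ENNReal.ofReal ((f x - f y) ^ 2 / ‖x - y‖ ^ ((n : ℝ) + 2 * s))
  have hg : Measurable (Function.uncurry g) := measurable_gagliardo_integrand s hf
  calc gagliardo s V (f ∘ T)
      ≤ ∫⁻ x in V, ∫⁻ y in V, (K ^ ((n : ℝ) + 2 * s) : ℝ≥0) * g (T x) (T y) :=
        lintegral_mono fun x => lintegral_mono fun y =>
          ofReal_sq_sub_comp_div_le hT (by positivity) f x y
    _ = (K ^ ((n : ℝ) + 2 * s) : ℝ≥0) * ∫⁻ x in V, ∫⁻ y in V, g (T x) (T y) := by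
        simp only [lintegral_const_mul' _ _ ENNReal.coe_ne_top]
    _ ≤ (K ^ ((n : ℝ) + 2 * s) : ℝ≥0) * ∫⁻ x in V, M * ∫⁻ y in Ω, g (T x) y := by
        gcongr with x
        exact lintegral_comp_le_of_map_le hTm hM hg.of_uncurry_left
    _ = (K ^ ((n : ℝ) + 2 * s) : ℝ≥0) * (M * ∫⁻ x in V, ∫⁻ y in Ω, g (T x) y) := by
        rw [lintegral_const_mul' _ _ ENNReal.coe_ne_top]
    _ ≤ (K ^ ((n : ℝ) + 2 * s) : ℝ≥0) * (M * (M * gagliardo s Ω f)) := by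
        gcongr
        exact lintegral_comp_le_of_map_le hTm hM hg.lintegral_prod_right'

theorem hsEnergy_comp_le (hs : 0 ≤ s) (hT : LipschitzWith K T)
    (hM : (volume.restrict V).map T ≤ M • volume.restrict Ω) {f : Rn n → ℝ} (hf : Measurable f) :
    hsEnergy s V (f ∘ T) ≤ ↑(M + K ^ ((n : ℝ) + 2 * s) * M * M) * hsEnergy s Ω f := by
  have hL2 : ∫⁻ x in V, ENNReal.ofReal ((f ∘ T) x ^ 2) ≤
      M * ∫⁻ x in Ω, ENNReal.ofReal (f x ^ 2) :=
    lintegral_comp_le_of_map_le hT.continuous.measurable hM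
      (F := fun x => ENNReal.ofReal (f x ^ 2)) (by fun_prop)
  refine (add_le_add hL2 (gagliardo_comp_le hs hT hM hf)).trans ?_
  rw [hsEnergy, ← mul_assoc, ← mul_assoc, mul_add]
  push_cast
  gcongr
  · exact le_self_add
  · exact le_add_self

end Composition

section Folding

theorem addHaar_image_le_of_lipschitzWith {E : Type*} [NormedAddCommGroup E] [NormedSpace ℝ E]
    [FiniteDimensional ℝ E] [MeasurableSpace E] [BorelSpace E] (μ : Measure E)
    [μ.IsAddHaarMeasure] {K : ℝ≥0} {f : E → E} (hf : LipschitzWith K f) (S : Set E) :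
    μ (f '' S) ≤ (K : ℝ≥0∞) ^ Module.finrank ℝ E * μ S := by
  rw [Measure.isAddLeftInvariant_eq_smul μ μH[Module.finrank ℝ E]]
  simp only [Measure.smul_apply, mul_smul_comm]
  gcongr
  simpa using hf.hausdorffMeasure_image_le (Nat.cast_nonneg (Module.finrank ℝ E)) S

variable {n : ℕ}

namespace Height

theorem volume_zero_set (h : Height n) : volume {x | h x = 0} = 0 := by
  have hlevel : ∀ t, volume {x | h x = t} = volume {x | h x = 0} := fun t => by
    rw [← measure_preimage_add_right volume (t • h.dir) {x | h x = t}]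
    simp only [preimage_ofPred_eq, h.add_smul, add_eq_right]
  by_contra hne
  have hcount := Measure.countable_meas_level_set_pos (μ := volume) h.measurable
  simp only [hlevel, pos_iff_ne_zero, ne_eq, hne, not_false_eq_true, ofPred_true] at hcount
  exact not_countable_univ hcount

theorem lipschitzWith_add_smul (h : Height n) {g : ℝ → ℝ} (hg : LipschitzWith 2 g) :
    LipschitzWith (1 + 2 * h.lip) fun y => y + g (h y) • h.dir := by
  have hsmul : LipschitzWith 1 fun t : ℝ => t • h.dir := by
    refine LipschitzWith.of_dist_le_mul fun t t' => ?_
    rw [dist_eq_norm, ← sub_smul, norm_smul, h.norm_dir, dist_eq_norm, NNReal.coe_one, one_mul,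
      mul_one]
  simpa only [one_mul, Function.comp_def, id_eq] using
    LipschitzWith.id.add (hsmul.comp (hg.comp h.lipschitz))

/-- The reflection across the graph `{h = 0}` along the vertical direction. -/
def reflect (h : Height n) (y : Rn n) : Rn n := y + (-2 * h y) • h.dir

/-- The map fixing the points above the graph `{h = 0}` and reflecting those below it. -/
def fold (h : Height n) (y : Rn n) : Rn n := y + (|h y| - h y) • h.dir

theorem lipschitzWith_reflect (h : Height n) : LipschitzWith (1 + 2 * h.lip) h.reflect := by
  refine h.lipschitzWith_add_smul (g := fun t => -2 * t) (LipschitzWith.of_dist_le_mul ?_)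
  intro t t'
  rw [Real.dist_eq, Real.dist_eq, ← mul_sub, abs_mul, abs_neg, abs_two, NNReal.coe_ofNat]

theorem lipschitzWith_fold (h : Height n) : LipschitzWith (1 + 2 * h.lip) h.fold := by
  refine h.lipschitzWith_add_smul (g := fun t => |t| - t) (LipschitzWith.of_dist_le_mul ?_)
  intro t t'
  rw [Real.dist_eq, Real.dist_eq, sub_sub_sub_comm, NNReal.coe_ofNat]
  linarith [abs_sub (|t| - |t'|) (t - t'), abs_abs_sub_abs_le t t']

theorem apply_reflect (h : Height n) (y : Rn n) : h (h.reflect y) = -h y := by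
  rw [reflect, h.add_smul]
  ring

theorem apply_fold (h : Height n) (y : Rn n) : h (h.fold y) = |h y| := by
  rw [fold, h.add_smul]
  ring

theorem reflect_reflect (h : Height n) (y : Rn n) : h.reflect (h.reflect y) = y := by
  rw [reflect, h.apply_reflect, reflect]
  module

theorem fold_of_nonneg (h : Height n) {y : Rn n} (hy : 0 ≤ h y) : h.fold y = y := by
  rw [fold, abs_of_nonneg hy, sub_self, zero_smul, add_zero]

theorem fold_of_nonpos (h : Height n) {y : Rn n} (hy : h y ≤ 0) : h.fold y = h.reflect y := by
  rw [fold, reflect, abs_of_nonpos hy]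
  ring_nf

theorem volume_preimage_fold_le (h : Height n) (A : Set (Rn n)) :
    volume (h.fold ⁻¹' A) ≤ ((1 + (1 + 2 * h.lip) ^ n : ℝ≥0) : ℝ≥0∞) * volume A := by
  have hsub : h.fold ⁻¹' A ⊆ A ∪ h.reflect '' A := fun y hy => by
    rcases le_total 0 (h y) with hle | hle
    · exact .inl (h.fold_of_nonneg hle ▸ hy)
    · exact .inr ⟨h.reflect y, h.fold_of_nonpos hle ▸ hy, h.reflect_reflect y⟩
  calc volume (h.fold ⁻¹' A) ≤ volume A + volume (h.reflect '' A) :=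
        (measure_mono hsub).trans (measure_union_le _ _)
    _ ≤ volume A + ((1 + 2 * h.lip : ℝ≥0) : ℝ≥0∞) ^ n * volume A := by
        gcongr
        simpa only [finrank_euclideanSpace_fin] using
          addHaar_image_le_of_lipschitzWith volume h.lipschitzWith_reflect A
    _ = ((1 + (1 + 2 * h.lip) ^ n : ℝ≥0) : ℝ≥0∞) * volume A := by
        push_cast
        ring

end Height

/-- A Lipschitz map carrying the bounded open set `domain` into `Ω`, up to a null set and with
bounded multiplicity, and fixing the points of `domain ∩ Ω`: composition with it extends functions
from `domain ∩ Ω` to `domain`. -/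
structure Folding (Ω : Set (Rn n)) where
  toFun : Rn n → Rn n
  domain : Set (Rn n)
  lip : ℝ≥0
  mult : ℝ≥0
  isOpen_domain : IsOpen domain
  isBounded_domain : Bornology.IsBounded domain
  lipschitz : LipschitzWith lip toFun
  map_le : (volume.restrict domain).map toFun ≤ mult • volume.restrict Ω
  fixed : ∀ y ∈ domain, y ∈ Ω → toFun y = y

variable {Ω : Set (Rn n)}

namespace Folding

instance : CoeFun (Folding Ω) fun _ => Rn n → Rn n := ⟨toFun⟩

/-- The identity, as a folding of `Ω` into itself. -/
def refl (hΩ : IsOpen Ω) (hΩ_bdd : Bornology.IsBounded Ω) : Folding Ω where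
  toFun := id
  domain := Ω
  lip := 1
  mult := 1
  isOpen_domain := hΩ
  isBounded_domain := hΩ_bdd
  lipschitz := LipschitzWith.id
  map_le := by rw [Measure.map_id, one_smul]
  fixed _ _ _ := rfl

theorem measurable (F : Folding Ω) : Measurable F := F.lipschitz.continuous.measurable

theorem comp_ae_eq (F : Folding Ω) {φ ψ : Rn n → ℝ} (h : φ =ᵐ[volume.restrict Ω] ψ) :
    φ ∘ F =ᵐ[volume.restrict F.domain] ψ ∘ F :=
  ae_of_ae_map F.measurable.aemeasurable
    ((Measure.absolutelyContinuous_of_le_smul F.map_le).ae_le h)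

end Folding

theorem BoundaryChart.fold_mem_ball (hΩ : IsOpen Ω) {x y : Rn n} (c : BoundaryChart Ω x)
    (hx : x ∈ frontier Ω) (hy : y ∈ ball x (c.radius / (1 + 2 * c.height.lip))) :
    c.height.fold y ∈ ball x c.radius := by
  have hxfold : c.height.fold x = x :=
    c.height.fold_of_nonneg (c.eq_zero_of_mem_frontier hΩ hx (mem_ball_self c.pos)).ge
  calc dist (c.height.fold y) x = dist (c.height.fold y) (c.height.fold x) := by rw [hxfold]
    _ ≤ (1 + 2 * c.height.lip) * dist y x := c.height.lipschitzWith_fold.dist_le_mul y x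
    _ < c.radius := by
        rwa [mem_ball, lt_div_iff₀' (by positivity)] at hy

/-- The fold of a boundary chart, on a ball that it maps into the ball of the chart. -/
def BoundaryChart.folding (hΩ : IsOpen Ω) {x : Rn n} (c : BoundaryChart Ω x)
    (hx : x ∈ frontier Ω) : Folding Ω where
  toFun := c.height.fold
  domain := ball x (c.radius / (1 + 2 * c.height.lip))
  lip := 1 + 2 * c.height.lip
  mult := 1 + (1 + 2 * c.height.lip) ^ n
  isOpen_domain := isOpen_ball
  isBounded_domain := isBounded_ball
  lipschitz := c.height.lipschitzWith_fold
  map_le := by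
    refine Measure.le_iff.2 fun A hA => ?_
    have hfm : Measurable c.height.fold := c.height.lipschitzWith_fold.continuous.measurable
    have hsub : c.height.fold ⁻¹' A ∩ ball x (c.radius / (1 + 2 * c.height.lip)) ⊆
        c.height.fold ⁻¹' (A ∩ Ω) ∪ {y | c.height y = 0} := by
      rintro y ⟨hyA, hyV⟩
      refine or_iff_not_imp_right.2 fun hy => ⟨hyA, (c.mem_iff _ (c.fold_mem_ball hΩ hx hyV)).2 ?_⟩
      rw [c.height.apply_fold]
      exact abs_pos.2 hy
    rw [Measure.map_apply hfm hA, Measure.restrict_apply (hfm hA)]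
    refine (measure_mono hsub).trans ((measure_union_le _ _).trans ?_)
    rw [c.height.volume_zero_set, add_zero, Measure.smul_apply, Measure.restrict_apply hA]
    exact c.height.volume_preimage_fold_le (A ∩ Ω)
  fixed y hy hyΩ := by
    have hlip : (1 : ℝ) ≤ 1 + 2 * c.height.lip := le_add_of_nonneg_right (by positivity)
    have hball := ball_subset_ball (div_le_self c.pos.le hlip) hy
    exact c.height.fold_of_nonneg ((c.mem_iff y hball).1 hyΩ).le

theorem exists_folding_mem_domain (hΩ : IsOpen Ω) (hΩ_bdd : Bornology.IsBounded Ω)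
    (hΩ_lip : HasLipschitzBoundary Ω) {x : Rn n} (hx : x ∈ closure Ω) :
    ∃ F : Folding Ω, x ∈ F.domain := by
  by_cases hxΩ : x ∈ Ω
  · exact ⟨.refl hΩ hΩ_bdd, hxΩ⟩
  have hfr : x ∈ frontier Ω := hΩ.frontier_eq ▸ ⟨hx, hxΩ⟩
  obtain ⟨c⟩ := hΩ_lip.nonempty_boundaryChart hfr
  exact ⟨c.folding hΩ hfr, mem_ball_self (div_pos c.pos (by positivity))⟩

end Folding

section Extension

variable {n : ℕ} {s : ℝ} {Ω : Set (Rn n)} {ι : Type*} [Fintype ι]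

theorem ofReal_sq_sum_div_le (a : ι → ℝ) {d : ℝ} (hd : 0 ≤ d) :
    ENNReal.ofReal ((∑ i, a i) ^ 2 / d) ≤
      Fintype.card ι * ∑ i, ENNReal.ofReal (a i ^ 2 / d) := by
  rw [← ENNReal.ofReal_sum_of_nonneg fun i _ => by positivity, ← ENNReal.ofReal_natCast,
    ← ENNReal.ofReal_mul (by positivity), ← Finset.sum_div, mul_div_assoc']
  refine ENNReal.ofReal_le_ofReal ?_
  gcongr
  exact sq_sum_le_card_mul_sum_sq

theorem lintegral_sq_sum_le {g : ι → Rn n → ℝ} (hg : ∀ i, Measurable (g i)) :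
    ∫⁻ x in Ω, ENNReal.ofReal ((∑ i, g i x) ^ 2) ≤
      Fintype.card ι * ∑ i, ∫⁻ x in Ω, ENNReal.ofReal (g i x ^ 2) := by
  rw [← lintegral_finsetSum _ fun i _ => by fun_prop,
    ← lintegral_const_mul' _ _ (ENNReal.natCast_ne_top _)]
  refine lintegral_mono fun x => ?_
  simpa only [div_one] using ofReal_sq_sum_div_le (fun i => g i x) zero_le_one

theorem gagliardo_sum_le {g : ι → Rn n → ℝ} (hg : ∀ i, Measurable (g i)) :
    gagliardo s Ω (fun x => ∑ i, g i x) ≤ Fintype.card ι * ∑ i, gagliardo s Ω (g i) := by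
  unfold gagliardo
  have hm i := measurable_gagliardo_integrand s (hg i)
  rw [← lintegral_finsetSum _ fun i _ => (hm i).lintegral_prod_right',
    ← lintegral_const_mul' _ _ (ENNReal.natCast_ne_top _)]
  refine lintegral_mono fun x => ?_
  rw [← lintegral_finsetSum _ fun i _ => by fun_prop,
    ← lintegral_const_mul' _ _ (ENNReal.natCast_ne_top _)]
  refine lintegral_mono fun y => ?_
  rw [← Finset.sum_sub_distrib]
  exact ofReal_sq_sum_div_le (fun i => g i x - g i y) (Real.rpow_nonneg (norm_nonneg _) _)

theorem hsEnergy_sum_le {g : ι → Rn n → ℝ} (hg : ∀ i, Measurable (g i)) :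
    hsEnergy s Ω (fun x => ∑ i, g i x) ≤ Fintype.card ι * ∑ i, hsEnergy s Ω (g i) := by
  unfold hsEnergy
  rw [Finset.sum_add_distrib, mul_add]
  exact add_le_add (lintegral_sq_sum_le hg) (gagliardo_sum_le hg)

/-- Finitely many foldings into `Ω` and Lipschitz weights supported in their domains and adding up
to `1` on `Ω`. Unlike in a partition of unity the weights may be negative. -/
structure FoldingPartition (Ω : Set (Rn n)) (ι : Type*) [Fintype ι] where
  folding : ι → Folding Ω
  weight : ι → Rn n → ℝ
  lip : ι → ℝ≥0
  lipschitz_weight : ∀ i, LipschitzWith (lip i) (weight i)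
  abs_weight_le_one : ∀ i x, |weight i x| ≤ 1
  weight_eq_zero : ∀ i, ∀ x ∈ (folding i).domainᶜ, weight i x = 0
  sum_weight : ∀ x ∈ Ω, ∑ i, weight i x = 1

open scoped Manifold in
theorem nonempty_foldingPartition (F : ι → Folding Ω) (hF : closure Ω ⊆ ⋃ i, (F i).domain) :
    Nonempty (FoldingPartition Ω ι) := by
  obtain ⟨f, hf⟩ := SmoothPartitionOfUnity.exists_isSubordinate 𝓘(ℝ, Rn n) isClosed_closure
    (fun i => (F i).domain) (fun i => (F i).isOpen_domain) hF
  have hlip : ∀ i, ∃ Λ : ℝ≥0, LipschitzWith Λ (f i) := fun i => by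
    have hsupp : HasCompactSupport (f i) := isCompact_of_isClosed_isBounded (isClosed_tsupport _)
      ((F i).isBounded_domain.subset (hf i))
    exact (f i).contMDiff.contDiff.lipschitzWith_of_hasCompactSupport hsupp (by simp)
  choose Λ hΛ using hlip
  exact ⟨{
    folding := F
    weight := fun i => f i
    lip := Λ
    lipschitz_weight := hΛ
    abs_weight_le_one := fun i x => (abs_of_nonneg (f.nonneg i x)).trans_le (f.le_one i x)
    weight_eq_zero := fun i x hx => image_eq_zero_of_notMem_tsupport fun h => hx (hf i h)
    sum_weight := fun x hx => by
      rw [← f.sum_eq_one (subset_closure hx), finsum_eq_sum_of_fintype] }⟩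

theorem exists_foldingPartition (hΩ : IsOpen Ω) (hΩ_bdd : Bornology.IsBounded Ω)
    (hΩ_lip : HasLipschitzBoundary Ω) :
    ∃ (ι : Type) (_ : Fintype ι), Nonempty (FoldingPartition Ω ι) := by
  choose F hF using fun x : closure Ω => exists_folding_mem_domain hΩ hΩ_bdd hΩ_lip x.2
  have hcompact : IsCompact (closure Ω) :=
    isCompact_of_isClosed_isBounded isClosed_closure hΩ_bdd.closure
  obtain ⟨t, ht⟩ := hcompact.elim_finite_subcover (fun x => (F x).domain)
    (fun x => (F x).isOpen_domain) fun x hx => mem_iUnion.2 ⟨⟨x, hx⟩, hF _⟩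
  refine ⟨t, inferInstance, nonempty_foldingPartition (fun x => F x) fun z hz => ?_⟩
  obtain ⟨x, hxt, hzx⟩ := mem_iUnion₂.1 (ht hz)
  exact mem_iUnion.2 ⟨⟨x, hxt⟩, hzx⟩

namespace FoldingPartition

variable (Φ : FoldingPartition Ω ι)

/-- The extension operator obtained by gluing the compositions with the foldings. -/
def extend (φ : Rn n → ℝ) (x : Rn n) : ℝ := ∑ i, Φ.weight i x * φ (Φ.folding i x)

theorem measurable_weight_mul {φ : Rn n → ℝ} (hφ : Measurable φ) (i : ι) :
    Measurable fun x => Φ.weight i x * φ (Φ.folding i x) :=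
  (Φ.lipschitz_weight i).continuous.measurable.mul (hφ.comp (Φ.folding i).measurable)

theorem measurable_extend {φ : Rn n → ℝ} (hφ : Measurable φ) : Measurable (Φ.extend φ) :=
  Finset.measurable_fun_sum _ fun i _ => Φ.measurable_weight_mul hφ i

theorem extend_congr_ae {φ ψ : Rn n → ℝ} (h : φ =ᵐ[volume.restrict Ω] ψ) :
    Φ.extend φ =ᵐ[volume] Φ.extend ψ := by
  have hcomp : ∀ᵐ x : Rn n, ∀ i, x ∈ (Φ.folding i).domain →
      φ (Φ.folding i x) = ψ (Φ.folding i x) := ae_all_iff.2 fun i =>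
    (ae_restrict_iff' (Φ.folding i).isOpen_domain.measurableSet).1 ((Φ.folding i).comp_ae_eq h)
  filter_upwards [hcomp] with x hx
  refine Finset.sum_congr rfl fun i _ => ?_
  by_cases hxi : x ∈ (Φ.folding i).domain
  · rw [hx i hxi]
  · rw [Φ.weight_eq_zero i x hxi, zero_mul, zero_mul]

theorem extend_apply_of_mem (φ : Rn n → ℝ) {x : Rn n} (hx : x ∈ Ω) : Φ.extend φ x = φ x := by
  have hterm : ∀ i, Φ.weight i x * φ (Φ.folding i x) = Φ.weight i x * φ x := fun i => by
    by_cases hxi : x ∈ (Φ.folding i).domain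
    · rw [(Φ.folding i).fixed x hxi hx]
    · rw [Φ.weight_eq_zero i x hxi, zero_mul, zero_mul]
  rw [extend, Finset.sum_congr rfl fun i _ => hterm i, ← Finset.sum_mul, Φ.sum_weight x hx,
    one_mul]

theorem extend_add_smul (a b : ℝ) (φ ψ : Rn n → ℝ) (x : Rn n) :
    Φ.extend (fun x => a * φ x + b * ψ x) x = a * Φ.extend φ x + b * Φ.extend ψ x := by
  simp only [extend, Finset.mul_sum]
  rw [← Finset.sum_add_distrib]
  exact Finset.sum_congr rfl fun i _ => by ring

theorem exists_hsEnergy_extend_le_of_measurable (hs0 : 0 < s) (hs1 : s < 1) :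
    ∃ B : ℝ≥0, ∀ φ : Rn n → ℝ, Measurable φ →
      hsEnergy s univ (Φ.extend φ) ≤ B * hsEnergy s Ω φ := by
  choose C hC using fun i => exists_hsEnergy_cutoff_le hs0 hs1 (Φ.lipschitz_weight i)
    (Φ.abs_weight_le_one i) (Φ.folding i).isOpen_domain.measurableSet (Φ.weight_eq_zero i)
  set D : ι → ℝ≥0 := fun i => (Φ.folding i).mult +
    (Φ.folding i).lip ^ ((n : ℝ) + 2 * s) * (Φ.folding i).mult * (Φ.folding i).mult
  refine ⟨Fintype.card ι * ∑ i, C i * D i, fun φ hφ => ?_⟩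
  have hterm : ∀ i, hsEnergy s univ (fun x => Φ.weight i x * φ (Φ.folding i x)) ≤
      (C i * D i : ℝ≥0) * hsEnergy s Ω φ := fun i => by
    refine (hC i _ (hφ.comp (Φ.folding i).measurable)).trans ?_
    rw [ENNReal.coe_mul, mul_assoc]
    gcongr
    exact hsEnergy_comp_le hs0.le (Φ.folding i).lipschitz (Φ.folding i).map_le hφ
  refine (hsEnergy_sum_le fun i => Φ.measurable_weight_mul hφ i).trans ?_
  rw [ENNReal.coe_mul, ENNReal.coe_natCast, ENNReal.ofNNReal_finsetSum, mul_assoc, Finset.sum_mul]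
  gcongr with i
  exact hterm i

theorem exists_hsNorm_extend_le (hs0 : 0 < s) (hs1 : s < 1) :
    ∃ K : ℝ≥0, ∀ φ : Rn n → ℝ, AEStronglyMeasurable φ (volume.restrict Ω) →
      hsNorm s univ (Φ.extend φ) ≤ K * hsNorm s Ω φ := by
  obtain ⟨B, hB⟩ := Φ.exists_hsEnergy_extend_le_of_measurable hs0 hs1
  refine ⟨B ^ (1 / 2 : ℝ), fun φ hφ => ?_⟩
  rw [hsNorm_eq_hsEnergy_rpow, hsNorm_eq_hsEnergy_rpow, ENNReal.coe_rpow_of_nonneg _ (by norm_num),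
    ← ENNReal.mul_rpow_of_nonneg _ _ (by simp), hsEnergy_congr_ae hφ.ae_eq_mk,
    hsEnergy_congr_ae (ae_restrict_of_ae (Φ.extend_congr_ae hφ.ae_eq_mk))]
  exact ENNReal.rpow_le_rpow (hB _ hφ.stronglyMeasurable_mk.measurable) (by simp)

theorem aestronglyMeasurable_extend {φ : Rn n → ℝ}
    (hφ : AEStronglyMeasurable φ (volume.restrict Ω)) : AEStronglyMeasurable (Φ.extend φ) :=
  (Φ.measurable_extend hφ.stronglyMeasurable_mk.measurable).aestronglyMeasurable.congr
    (Φ.extend_congr_ae hφ.ae_eq_mk).symm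

theorem exists_isHsExtension (hΩ : MeasurableSet Ω) (hs0 : 0 < s) (hs1 : s < 1) :
    ∃ K : ℝ≥0, IsHsExtension s Ω K Φ.extend := by
  obtain ⟨K, hK⟩ := Φ.exists_hsNorm_extend_le hs0 hs1
  refine ⟨K, ?_, fun φ _ => ?_, fun a b φ ψ _ _ => ?_, fun φ hφ => hK φ hφ.1⟩
  · intro φ hφ
    exact ⟨(Φ.aestronglyMeasurable_extend hφ.1).restrict,
      (hK φ hφ.1).trans_lt (ENNReal.mul_lt_top ENNReal.coe_lt_top hφ.2)⟩
  · exact (ae_restrict_mem hΩ).mono fun x hx => Φ.extend_apply_of_mem φ hx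
  · exact .of_forall fun x => Φ.extend_add_smul a b φ ψ x

end FoldingPartition

theorem exists_isHsExtension (hΩ : IsOpen Ω) (hΩ_bdd : Bornology.IsBounded Ω)
    (hΩ_lip : HasLipschitzBoundary Ω) (hs0 : 0 < s) (hs1 : s < 1) :
    ∃ (K : ℝ≥0) (P : (Rn n → ℝ) → (Rn n → ℝ)), IsHsExtension s Ω K P := by
  obtain ⟨ι, _, ⟨Φ⟩⟩ := exists_foldingPartition hΩ hΩ_bdd hΩ_lip
  obtain ⟨K, hK⟩ := Φ.exists_isHsExtension hΩ.measurableSet hs0 hs1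
  exact ⟨K, Φ.extend, hK⟩

end Extension

namespace IsHsExtension

variable {n : ℕ} {s : ℝ} {Ω : Set (Rn n)} {K : ℝ≥0} {P : (Rn n → ℝ) → (Rn n → ℝ)} {φ : Rn n → ℝ}

theorem aemeasurable (hP : IsHsExtension s Ω K P) (hφ : MemHs s Ω φ) : AEMeasurable (P φ) := by
  simpa only [Measure.restrict_univ] using (hP.memHs φ hφ).1.aemeasurable

theorem le_ofReal_mul_hsNorm (hP : IsHsExtension s Ω K P) (hφ : MemHs s Ω φ) {N : ℝ≥0∞}
    {c C b : ℝ} (hC : c * K ≤ C) (hb : 0 ≤ b)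
    (hN : N ≤ ENNReal.ofReal (c * b) * hsNorm s univ (P φ)) :
    N ≤ ENNReal.ofReal (C * b) * hsNorm s Ω φ :=
  calc N ≤ ENNReal.ofReal (c * b) * (K * hsNorm s Ω φ) :=
      hN.trans (mul_le_mul_right (hP.norm_le φ hφ) _)
    _ = ENNReal.ofReal (c * K * b) * hsNorm s Ω φ := by
      rw [← mul_assoc, ← ENNReal.ofReal_coe_nnreal, ← ENNReal.ofReal_mul' K.coe_nonneg,
        mul_right_comm]
    _ ≤ ENNReal.ofReal (C * b) * hsNorm s Ω φ := by gcongr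

theorem eLpNorm_sub_restrict_le (hP : IsHsExtension s Ω K P) (hφ : MemHs s Ω φ)
    (f : Rn n → ℝ) :
    eLpNorm (fun x => φ x - f x) 2 (volume.restrict Ω) ≤
      eLpNorm (fun x => P φ x - f x) 2 volume :=
  calc eLpNorm (fun x => φ x - f x) 2 (volume.restrict Ω)
      = eLpNorm (fun x => P φ x - f x) 2 (volume.restrict Ω) :=
        eLpNorm_congr_ae ((hP.extends_ae φ hφ).symm.sub .rfl)
    _ ≤ eLpNorm (fun x => P φ x - f x) 2 volume := eLpNorm_mono_measure _ Measure.restrict_le_self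

end IsHsExtension

theorem lemma2p4 {n : ℕ} (hn : 0 < n) (Ω : Set (Rn n)) (hΩ_open : IsOpen Ω)
    (hΩ_bdd : Bornology.IsBounded Ω) (hΩ_lip : HasLipschitzBoundary Ω)
    (s : ℝ) (hs0 : 0 < s) (hs1 : s < 1) :
    (∃ (K : ℝ≥0) (P : (Rn n → ℝ) → (Rn n → ℝ)), IsHsExtension s Ω K P) ∧
    ∀ K : ℝ≥0, ∃ C : ℝ, 0 < C ∧
      ∀ P : (Rn n → ℝ) → (Rn n → ℝ), IsHsExtension s Ω K P →
      ∀ ε : ℝ, 0 < ε → ∀ φ : Rn n → ℝ, MemHs s Ω φ →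
        eLpNorm (fun x => φ x - cellAverage ε (P φ) x) 2 (volume.restrict Ω)
            ≤ ENNReal.ofReal (C * ε ^ s) * hsNorm s Ω φ ∧
        eLpNorm (fun x => φ x - q1Interp ε (P φ) x) 2 (volume.restrict Ω)
            ≤ ENNReal.ofReal (C * ε ^ s) * hsNorm s Ω φ ∧
        (∃ G : Rn n → Rn n,
          HasWeakGradientOn (enlargement Ω ε 3) (q1Interp ε (P φ)) G ∧
          eLpNorm G 2 (volume.restrict (enlargement Ω ε 3))
            ≤ ENNReal.ofReal (C * ε ^ (s - 1)) * hsNorm s Ω φ) ∧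
        eLpNorm (P φ) 2 (volume.restrict (boundaryLayer Ω ε 3))
            ≤ ENNReal.ofReal (C * ε ^ (s / 2)) * hsNorm s Ω φ ∧
        (∀ i : Fin n,
          eLpNorm (fun x => φ x - P φ (x + ε • EuclideanSpace.single i (1 : ℝ))) 2
              (volume.restrict Ω)
            ≤ ENNReal.ofReal (C * ε ^ s) * hsNorm s Ω φ) ∧
        eLpNorm (q1Interp ε (P φ)) 2 (surfaceMeasure Ω)
            ≤ ENNReal.ofReal (C * ε ^ ((s - 1) / 2)) * hsNorm s Ω φ := by
  refine ⟨exists_isHsExtension hΩ_open hΩ_bdd hΩ_lip hs0 hs1, fun K => ?_⟩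
  obtain ⟨c₁, average_le⟩ := exists_eLpNorm_sub_cellAverage_le n hs0.le
  obtain ⟨c₂, interp_le⟩ := exists_eLpNorm_sub_q1Interp_le n hs0.le
  obtain ⟨c₃, gradient_le⟩ := exists_hasWeakGradientOn_q1Interp_eLpNorm_le n hs0.le
  obtain ⟨c₄, layer_le⟩ := exists_eLpNorm_boundaryLayer_le hΩ_open hΩ_bdd hΩ_lip hs0 hs1 3
  obtain ⟨c₅, translate_le⟩ := exists_eLpNorm_sub_translate_le n hs0
  obtain ⟨c₆, surface_le⟩ :=
    exists_eLpNorm_q1Interp_surfaceMeasure_le hn hΩ_open hΩ_bdd hΩ_lip hs0 hs1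
  set c := c₁ ⊔ c₂ ⊔ c₃ ⊔ c₄ ⊔ c₅ ⊔ c₆
  refine ⟨c * K + 1, by positivity, fun P hP ε hε φ hφ => ?_⟩
  have hu : AEMeasurable (P φ) := hP.aemeasurable hφ
  have transfer {N : ℝ≥0∞} {p : ℝ} (d : ℝ≥0) (hd : d ≤ c)
      (hN : N ≤ ENNReal.ofReal (d * ε ^ p) * hsNorm s univ (P φ)) :
      N ≤ ENNReal.ofReal ((c * K + 1) * ε ^ p) * hsNorm s Ω φ :=
    hP.le_ofReal_mul_hsNorm hφ (le_add_of_le_of_nonneg (by gcongr) zero_le_one) (by positivity) hN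
  refine ⟨transfer c₁ (by simp [c]) ?_, transfer c₂ (by simp [c]) ?_,
    (gradient_le ε hε (P φ) (hP.memHs φ hφ) _).imp fun G hG =>
      hG.imp_right (transfer c₃ (by simp [c])),
    transfer c₄ (by simp [c]) (layer_le ε hε _ hu), fun i => transfer c₅ (by simp [c]) ?_,
    transfer c₆ (by simp [c]) (surface_le ε hε _ hu)⟩
  · exact (hP.eLpNorm_sub_restrict_le hφ _).trans (average_le ε hε _ hu)
  · exact (hP.eLpNorm_sub_restrict_le hφ _).trans (interp_le ε hε _ hu)
  · have hnorm : ‖(ε • EuclideanSpace.single i 1 : Rn n)‖ = ε := by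
      rw [norm_smul, PiLp.norm_single, norm_one, mul_one, Real.norm_of_nonneg hε.le]
    exact (hP.eLpNorm_sub_restrict_le hφ _).trans ((translate_le _ hu _).trans_eq (by rw [hnorm]))
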